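/- Fix a field $\mathbb F$ and $n\in\mathbb N$. A type of length $n$ is a sequence $\tau\in\{\to,\leftarrow\}^{n-1}$. A $\tau$-module $\mathbb V=(V_i,p_i)$ consists of finite-dimensional $\mathbb F$-vector spaces $V_1,\dots,V_n$ and linear maps $p_i$ between $V_i$ and $V_{i+1}$ whose directions are given by $\tau$. Isomorphisms ($\cong$) and direct sums of $\tau$-modules are taken componentwise. For $1\le b\le d\le n$ the interval module $\mathbb I_\tau([b,d])$ has the space $\mathbb F$ at the indices in $[b,d]$ and $0$ elsewhere, with identity maps inside $[b,d]$ and zero maps elsewhere. The persistence diagram $\mathrm{Dgm}(\mathbb V)$ is the multiset of pairs $(b,d)$ (unique by the Krull–Remak–Schmidt and Gabriel theorems) with $\mathbb V\cong\bigoplus_{(b,d)\in\mathrm{Dgm}(\mathbb V)}\mathbb I_\tau([b,d])$, and $\mathcal S(\mathbb V):=\bigoplus_{(b,d)\in\mathrm{Dgm}(\mathbb V),\,b\ne d}\mathbb I_\tau([b,d])$. For modules of length $n$ and arbitrary types, write $\mathbb W\sim\mathbb W'$ if $\mathbb W'$ is isomorphic to a module obtained from $\mathbb W$ by finitely many (possibly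 zero) steps, each replacing a structure map that is an isomorphism by its inverse (with reversed arrow). Write $\mathbb W\precsim\mathbb V$ if there are $\mathbb W'\sim\mathbb W$ and $\mathbb U$, both of the same type as $\mathbb V$, with $\mathbb V\cong\mathbb W'\oplus\mathbb U$. A reflection at index $k$, $1<k<n$, is one of two operations: $\mathcal L_k$ replaces $V_k$ by the limit $L$ of the diagram $V_{k-1}\leftrightarrow V_k\leftrightarrow V_{k+1}$, with its projections $V_{k-1}\leftarrow L\to V_{k+1}$, and $\mathcal C_k$ replaces $V_k$ by the colimit $C$ of that diagram, with its canonical maps $V_{k-1}\to C\leftarrow V_{k+1}$. At $k=1$ and at $k=n$ the same operations are used with the diagrams $0\leftrightarrow V_1\leftrightarrow V_2$ and $V_{n-1}\leftrightarrow V_n\leftrightarrow 0$ (omitting from the result the map to or from the added $0$), where the direction of the arrow between the added $0$ and $V_1$ or $V_n$ is chosen freely each time; so there are four reflections at each of these indices. For a finite sequence $\mathfrak R=(\mathcal R_\ell,\dots,\mathcal R_1)$ of reflections of length $\ell\geq 0$ put $$\mathfrak R(\mathbb V):=(\mathcal S\circ\mathcal R_\ell\circ\mathcal S\circ\cdots\circ\mathcal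 S\circ\mathcal R_1\circ\mathcal S)(\mathbb V),\qquad C_1(\mathfrak R):=\ell,$$ so that the empty sequence has cost $0$ and acts as $\mathcal S$. The $1$-reflection distance is $$d_{\mathcal R}^1(\mathbb V,\mathbb W):=\min\big\{\max\{C_1(\mathfrak R),C_1(\mathfrak R')\}\ \big|\ \mathfrak R(\mathbb V)\precsim\mathbb W,\ \mathfrak R'(\mathbb W)\precsim\mathbb V\big\}.$$ A matching $M$ between finite multisets $S,T$ of points of $\mathbb R^2$ is a relation under which each element of $S$ (counted with multiplicity) is related to at most one element of $T$, and vice versa. The bottleneck distance is $$d_b^\infty(S,T):=\inf_M\max\Big\{\max_{(s,t)\in M}\|s-t\|_\infty,\ \max_{r\in S\sqcup T\text{ unmatched}}\tfrac12|r_y-r_x|\Big\},$$ a maximum over the empty set being $0$. **Corollary.** Fix $n\in\mathbb N$ and a type $\tau\in\{\to,\leftarrow\}^{n-1}$. For all $\tau$-modules $\mathbb V,\mathbb W$ the distance $d_{\mathcal R}^1(\mathbb V,\mathbb W)$ is finite, and $$d_b^\infty(\mathrm{Dgm}(\mathbb V),\mathrm{Dgm}(\mathbb W))\ \le\ d_{\mathcal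 R}^1(\mathbb V,\mathbb W)\ \le\ 2n^2(n+1)\cdot d_b^\infty(\mathrm{Dgm}(\mathbb V),\mathrm{Dgm}(\mathbb W)).$$ -/

import Mathlib

open scoped ENNReal

universe u

namespace Zigzag

noncomputable section

/-! ### Types of zigzag modules

Positions `1, …, n` are represented by `Fin n` (so `i : Fin n` is position `i + 1`), and the
arrows `1, …, n - 1` by `Fin (n - 1)`; arrow `i` joins `lo i` to `hi i`. -/

/-- The two symbols `→` and `←`. -/
inductive Dir
  | right
  | left
  deriving DecidableEq

/-- The opposite symbol. -/
def Dir.flip : Dir → Dir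
  | .right => .left
  | .left => .right

/-- Types of zigzag modules of length `n`: sequences in `{→, ←}^(n-1)`. -/
abbrev ZType (n : ℕ) := Fin (n - 1) → Dir

variable {n : ℕ}

/-- The left end of the `i`-th arrow. -/
def lo (i : Fin (n - 1)) : Fin n := ⟨i, by omega⟩

/-- The right end of the `i`-th arrow. -/
def hi (i : Fin (n - 1)) : Fin n := ⟨i + 1, by omega⟩

theorem lo_ne_hi (i : Fin (n - 1)) : lo i ≠ hi i := by
  simp [lo, hi]

/-- `r_k τ`: the `k`-th arrow is reversed. -/
def reverseAt (k : Fin (n - 1)) (τ : ZType n) : ZType n :=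
  fun i => if i = k then (τ i).flip else τ i

/-- `σ_k τ`: place a source at position `k`. -/
def extrovert (k : Fin n) (τ : ZType n) : ZType n :=
  fun i => if lo i = k then .right else if hi i = k then .left else τ i

/-- `ζ_k τ`: place a sink at position `k`. -/
def introvert (k : Fin n) (τ : ZType n) : ZType n :=
  fun i => if lo i = k then .left else if hi i = k then .right else τ i

theorem of_extrovert_right {k : Fin n} {τ : ZType n} {i : Fin (n - 1)}
    (h : extrovert k τ i = .right) (h1 : lo i ≠ k) : hi i ≠ k ∧ τ i = .right := by
  by_cases h2 : hi i = k <;> simp_all [extrovert]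

theorem of_extrovert_left {k : Fin n} {τ : ZType n} {i : Fin (n - 1)}
    (h : extrovert k τ i = .left) : lo i ≠ k ∧ (hi i ≠ k → τ i = .left) := by
  by_cases h1 : lo i = k <;> by_cases h2 : hi i = k <;> simp_all [extrovert]

theorem of_introvert_left {k : Fin n} {τ : ZType n} {i : Fin (n - 1)}
    (h : introvert k τ i = .left) (h1 : lo i ≠ k) : hi i ≠ k ∧ τ i = .left := by
  by_cases h2 : hi i = k <;> simp_all [introvert]

theorem of_introvert_right {k : Fin n} {τ : ZType n} {i : Fin (n - 1)}
    (h : introvert k τ i = .right) : lo i ≠ k ∧ (hi i ≠ k → τ i = .right) := by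
  by_cases h1 : lo i = k <;> by_cases h2 : hi i = k <;> simp_all [introvert]

theorem of_reverseAt_eq {k i : Fin (n - 1)} {τ : ZType n} {d : Dir}
    (h : reverseAt k τ i = d) (hik : i = k) : τ i = d.flip := by
  subst h
  cases h : τ i <;> simp [reverseAt, hik, Dir.flip] <;> simp_all

theorem of_reverseAt_ne {k i : Fin (n - 1)} {τ : ZType n} {d : Dir}
    (h : reverseAt k τ i = d) (hik : i ≠ k) : τ i = d := by
  simpa [reverseAt, hik] using h

/-! ### Zigzag modules -/

/-- Zigzag modules of type `τ` over `F`: finite dimensional spaces at the positions, and for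
each arrow one linear map, in the direction prescribed by `τ`. -/
structure Mod (F : Type u) [Field F] (τ : ZType n) where
  space : Fin n → ModuleCat.{u} F
  finite : ∀ i, Module.Finite F (space i)
  fwd : ∀ i, τ i = .right → (space (lo i) →ₗ[F] space (hi i))
  bwd : ∀ i, τ i = .left → (space (hi i) →ₗ[F] space (lo i))

attribute [instance] Mod.finite

variable {F : Type u} [Field F] {τ τ' : ZType n}

/-- `V ≅ W` as `τ`-modules. -/
def Mod.Iso (V W : Mod F τ) : Prop :=
  ∃ φ : ∀ i, V.space i ≃ₗ[F] W.space i,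
    (∀ i h x, φ (hi i) (V.fwd i h x) = W.fwd i h (φ (lo i) x)) ∧
    (∀ i h x, φ (lo i) (V.bwd i h x) = W.bwd i h (φ (hi i) x))

/-- The direct sum of two `τ`-modules. -/
def Mod.sum (V W : Mod F τ) : Mod F τ where
  space i := ModuleCat.of F (V.space i × W.space i)
  finite i := inferInstanceAs (Module.Finite F (V.space i × W.space i))
  fwd i h := (V.fwd i h).prodMap (W.fwd i h)
  bwd i h := (V.bwd i h).prodMap (W.bwd i h)

/-- The direct sum of a finite family of `τ`-modules. -/
def Mod.bigSum {ι : Type} [Fintype ι] (X : ι → Mod F τ) : Mod F τ where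
  space i := ModuleCat.of F (∀ j, (X j).space i)
  finite i := inferInstanceAs (Module.Finite F (∀ j, (X j).space i))
  fwd i h := LinearMap.pi fun j => (X j).fwd i h ∘ₗ LinearMap.proj j
  bwd i h := LinearMap.pi fun j => (X j).bwd i h ∘ₗ LinearMap.proj j

/-- `W ⪯ V`: `W` is a summand of `V`. -/
def Mod.IsSummand (W V : Mod F τ) : Prop := ∃ U : Mod F τ, V.Iso (W.sum U)

/-! ### Interval modules and persistence diagrams -/

/-- Pairs `(b, d)` of positions with `b ≤ d`. -/
abbrev Interval (n : ℕ) := {p : Fin n × Fin n // p.1 ≤ p.2}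

/-- The position `i` lies in `[b, d]`. -/
def Interval.Mem (I : Interval n) (i : Fin n) : Prop := I.1.1 ≤ i ∧ i ≤ I.1.2

open Classical in
/-- The space `F` (as `⊤`) at the positions in `[b, d]` and `0` (as `⊥`) elsewhere. -/
def Interval.space (F : Type u) [Field F] (I : Interval n) (i : Fin n) : Submodule F F :=
  if I.Mem i then ⊤ else ⊥

open Classical in
/-- The map between the spaces at two positions: the identity of `F` if both lie in `[b, d]`,
and `0` otherwise. -/
def Interval.map (F : Type u) [Field F] (I : Interval n) (i j : Fin n) :
    I.space F i →ₗ[F] I.space F j :=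
  if h : I.Mem i ∧ I.Mem j then
    Submodule.inclusion (show I.space F i ≤ I.space F j by simp [Interval.space, h])
  else 0

/-- The interval `τ`-module on `[b, d]`. -/
def intervalMod (F : Type u) [Field F] (τ : ZType n) (I : Interval n) : Mod F τ where
  space i := ModuleCat.of F (I.space F i)
  finite i := inferInstanceAs (Module.Finite F (I.space F i))
  fwd i _ := I.map F (lo i) (hi i)
  bwd i _ := I.map F (hi i) (lo i)

/-- The direct sum of the interval `τ`-modules on the elements of a multiset, counted with
multiplicity. -/
def intervalSum (F : Type u) [Field F] (τ : ZType n) (D : Multiset (Interval n)) : Mod F τ :=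
  Mod.bigSum fun j : D.ToType => intervalMod F τ j.1

/-- The persistence diagram: the multiset of intervals (unique by the Krull-Remak-Schmidt and
Gabriel theorems) in a decomposition of `V` into interval modules. -/
def Mod.dgm (V : Mod F τ) : Multiset (Interval n) :=
  Classical.epsilon fun D => V.Iso (intervalSum F τ D)

/-- The persistence diagram as a multiset of points `(b, d)` of the plane, with
`b, d ∈ {1, …, n}`. -/
def Mod.dgmPoints (V : Mod F τ) : Multiset (ℝ × ℝ) :=
  V.dgm.map fun I => (((I.1.1 : ℕ) : ℝ) + 1, ((I.1.2 : ℕ) : ℝ) + 1)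

/-- `𝒮(V)`: remove the simple summands. -/
def Mod.removeSimple (V : Mod F τ) : Mod F τ :=
  intervalSum F τ (V.dgm.filter fun I => I.1.1 ≠ I.1.2)

/-! ### Arrow reversals, the equivalence `∼` and the preorder `≾` -/

/-- The `k`-th structure map is an isomorphism. -/
def Mod.IsIsoAt (V : Mod F τ) (k : Fin (n - 1)) : Prop :=
  (∀ h, Function.Bijective (V.fwd k h)) ∧ (∀ h, Function.Bijective (V.bwd k h))

/-- `𝒜_k(V)`: replace the `k`-th structure map, an isomorphism, by its inverse. -/
def Mod.reverse (V : Mod F τ) (k : Fin (n - 1)) (hk : V.IsIsoAt k) :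
    Mod F (reverseAt k τ) where
  space := V.space
  finite := V.finite
  fwd i h :=
    if hik : i = k then
      (LinearEquiv.ofBijective (V.bwd i (of_reverseAt_eq h hik))
        ((show V.IsIsoAt i from hik ▸ hk).2 _)).symm.toLinearMap
    else V.fwd i (of_reverseAt_ne h hik)
  bwd i h :=
    if hik : i = k then
      (LinearEquiv.ofBijective (V.fwd i (of_reverseAt_eq h hik))
        ((show V.IsIsoAt i from hik ▸ hk).1 _)).symm.toLinearMap
    else V.bwd i (of_reverseAt_ne h hik)

/-- `V ∼ W`: a finite, possibly empty, sequence of arrow reversals carries `V` to a module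
isomorphic to `W`. -/
inductive Sim : {τ τ' : ZType n} → Mod F τ → Mod F τ' → Prop
  | iso {τ : ZType n} {V W : Mod F τ} (h : V.Iso W) : Sim V W
  | reverse {τ τ' : ZType n} {V : Mod F τ} {W : Mod F τ'} (k : Fin (n - 1))
      (hk : V.IsIsoAt k) (h : Sim (V.reverse k hk) W) : Sim V W

/-- `W ≾ V`: there is `W'` with `W ∼ W'` and `W' ⪯ V`. -/
def Precsim (W : Mod F τ') (V : Mod F τ) : Prop :=
  ∃ W' : Mod F τ, Sim W W' ∧ W'.IsSummand V

/-! ### Reflections -/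

/-- The positions `k - 1, k, k + 1` (those of them that exist). -/
abbrev Nbhd (k : Fin n) := {j : Fin n // (j : ℕ) ≤ k + 1 ∧ (k : ℕ) ≤ j + 1}

/-- The position `k` itself. -/
def nbhdCenter (k : Fin n) : Nbhd k := ⟨k, by omega⟩

/-- The left end of an arrow that touches `k`. -/
def nbhdLo {k : Fin n} {i : Fin (n - 1)} (h : lo i = k ∨ hi i = k) : Nbhd k :=
  ⟨lo i, by rcases h with rfl | rfl <;> grind [lo, hi]⟩

/-- The right end of an arrow that touches `k`. -/
def nbhdHi {k : Fin n} {i : Fin (n - 1)} (h : lo i = k ∨ hi i = k) : Nbhd k :=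
  ⟨hi i, by rcases h with rfl | rfl <;> grind [lo, hi]⟩

/-- The limit of the diagram `V_{k-1} ↔ V_k ↔ V_{k+1}`, as the space of compatible families. If
`k` is the first or the last position, the missing space is `0` and `e` is the direction of the
arrow `0 ↔ V_1` or `V_n ↔ 0`: an arrow out of `0` forces the component at `k` to vanish, and an
arrow into `0` imposes nothing. -/
def Mod.lim (V : Mod F τ) (k : Fin n) (e : Dir) : Submodule F (∀ j : Nbhd k, V.space j) where
  carrier := {x |
    (∀ i (t : lo i = k ∨ hi i = k) (h : τ i = .right),
      V.fwd i h (x (nbhdLo t)) = x (nbhdHi t)) ∧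
    (∀ i (t : lo i = k ∨ hi i = k) (h : τ i = .left),
      V.bwd i h (x (nbhdHi t)) = x (nbhdLo t)) ∧
    ((k : ℕ) = 0 → e = .right → x (nbhdCenter k) = 0) ∧
    ((k : ℕ) + 1 = n → e = .left → x (nbhdCenter k) = 0)}
  zero_mem' := by
    refine ⟨fun i t h => ?_, fun i t h => ?_, fun _ _ => rfl, fun _ _ => rfl⟩
    · exact map_zero (V.fwd i h)
    · exact map_zero (V.bwd i h)
  add_mem' := by
    rintro x y ⟨h1, h2, h3, h4⟩ ⟨g1, g2, g3, g4⟩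
    refine ⟨fun i t h => ?_, fun i t h => ?_, fun a b => ?_, fun a b => ?_⟩
    · exact (map_add (V.fwd i h) _ _).trans (congrArg₂ _ (h1 i t h) (g1 i t h))
    · exact (map_add (V.bwd i h) _ _).trans (congrArg₂ _ (h2 i t h) (g2 i t h))
    · exact (congrArg₂ _ (h3 a b) (g3 a b)).trans (add_zero _)
    · exact (congrArg₂ _ (h4 a b) (g4 a b)).trans (add_zero _)
  smul_mem' := by
    rintro c x ⟨h1, h2, h3, h4⟩
    refine ⟨fun i t h => ?_, fun i t h => ?_, fun a b => ?_, fun a b => ?_⟩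
    · exact (map_smul (V.fwd i h) _ _).trans (congrArg _ (h1 i t h))
    · exact (map_smul (V.bwd i h) _ _).trans (congrArg _ (h2 i t h))
    · exact (congrArg _ (h3 a b)).trans (smul_zero c)
    · exact (congrArg _ (h4 a b)).trans (smul_zero c)

/-- The projections of the limit. -/
def Mod.limProj (V : Mod F τ) (k : Fin n) (e : Dir) (j : Nbhd k) :
    V.lim k e →ₗ[F] V.space j :=
  LinearMap.proj j ∘ₗ (V.lim k e).subtype

/-- The inclusions into the direct sum of the spaces at `k - 1, k, k + 1`. -/
def Mod.nbhdSingle (V : Mod F τ) (k : Fin n) (j : Nbhd k) :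
    V.space j →ₗ[F] (∀ j : Nbhd k, V.space j) :=
  LinearMap.single F (fun j : Nbhd k => V.space j) j

/-- The relations that define the colimit of the diagram `V_{k-1} ↔ V_k ↔ V_{k+1}`: each element
is identified with its image under each arrow. If `k` is the first or the last position, the
missing space is `0` and `e` is the direction of the arrow `0 ↔ V_1` or `V_n ↔ 0`: an arrow into
`0` kills the space at `k`, and an arrow out of `0` imposes nothing. -/
def Mod.colimRel (V : Mod F τ) (k : Fin n) (e : Dir) :
    Submodule F (∀ j : Nbhd k, V.space j) :=
  Submodule.span F (
    {z | ∃ (i : Fin (n - 1)) (t : lo i = k ∨ hi i = k) (h : τ i = .right) (x : V.space (lo i)),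
      z = V.nbhdSingle k (nbhdLo t) x - V.nbhdSingle k (nbhdHi t) (V.fwd i h x)} ∪
    {z | ∃ (i : Fin (n - 1)) (t : lo i = k ∨ hi i = k) (h : τ i = .left) (x : V.space (hi i)),
      z = V.nbhdSingle k (nbhdHi t) x - V.nbhdSingle k (nbhdLo t) (V.bwd i h x)} ∪
    {z | (((k : ℕ) = 0 ∧ e = .left) ∨ ((k : ℕ) + 1 = n ∧ e = .right)) ∧
      ∃ x : V.space k, z = V.nbhdSingle k (nbhdCenter k) x})

/-- The colimit of the diagram `V_{k-1} ↔ V_k ↔ V_{k+1}`. -/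
abbrev Mod.colim (V : Mod F τ) (k : Fin n) (e : Dir) :=
  (∀ j : Nbhd k, V.space j) ⧸ V.colimRel k e

/-- The injections into the colimit. -/
def Mod.colimInj (V : Mod F τ) (k : Fin n) (e : Dir) (j : Nbhd k) :
    V.space j →ₗ[F] V.colim k e :=
  (V.colimRel k e).mkQ ∘ₗ V.nbhdSingle k j

/-- Replace the `k`-th space of a sequence of spaces by `L`. -/
def replace (X : Fin n → ModuleCat.{u} F) (k : Fin n) (L : ModuleCat.{u} F) (i : Fin n) :
    ModuleCat.{u} F :=
  if i = k then L else X i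

/-- At position `k` the new space is `L`. -/
def replaceAt (X : Fin n → ModuleCat.{u} F) (k : Fin n) (L : ModuleCat.{u} F) (i : Fin n)
    (h : i = k) : replace X k L i ≃ₗ[F] L :=
  (CategoryTheory.eqToIso (if_pos h : replace X k L i = L)).toLinearEquiv

/-- At the other positions the spaces are the old ones. -/
def replaceAway (X : Fin n → ModuleCat.{u} F) (k : Fin n) (L : ModuleCat.{u} F) (i : Fin n)
    (h : i ≠ k) : replace X k L i ≃ₗ[F] X i :=
  (CategoryTheory.eqToIso (if_neg h : replace X k L i = X i)).toLinearEquiv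

theorem replace_finite (X : Fin n → ModuleCat.{u} F) (k : Fin n) (L : ModuleCat.{u} F)
    (hX : ∀ i, Module.Finite F (X i)) (hL : Module.Finite F L) (i : Fin n) :
    Module.Finite F (replace X k L i) := by
  by_cases h : i = k
  · rwa [replace, if_pos h]
  · rw [replace, if_neg h]
    exact hX i

/-- `ℒ_k(V)`: the space at `k` is replaced by the limit, with its projections to the spaces at
`k - 1` and `k + 1`. -/
def Mod.reflectLim (V : Mod F τ) (k : Fin n) (e : Dir) : Mod F (extrovert k τ) where
  space := replace V.space k (ModuleCat.of F (V.lim k e))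
  finite := replace_finite _ _ _ V.finite (inferInstanceAs (Module.Finite F (V.lim k e)))
  fwd i h :=
    if h1 : lo i = k then
      (replaceAway V.space k _ (hi i) (fun h2 => lo_ne_hi i (h1.trans h2.symm))).symm.toLinearMap ∘ₗ
        V.limProj k e (nbhdHi (.inl h1)) ∘ₗ (replaceAt V.space k _ (lo i) h1).toLinearMap
    else
      (replaceAway V.space k _ (hi i) (of_extrovert_right h h1).1).symm.toLinearMap ∘ₗ
        V.fwd i (of_extrovert_right h h1).2 ∘ₗ (replaceAway V.space k _ (lo i) h1).toLinearMap
  bwd i h :=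
    if h2 : hi i = k then
      (replaceAway V.space k _ (lo i) (of_extrovert_left h).1).symm.toLinearMap ∘ₗ
        V.limProj k e (nbhdLo (.inr h2)) ∘ₗ (replaceAt V.space k _ (hi i) h2).toLinearMap
    else
      (replaceAway V.space k _ (lo i) (of_extrovert_left h).1).symm.toLinearMap ∘ₗ
        V.bwd i ((of_extrovert_left h).2 h2) ∘ₗ (replaceAway V.space k _ (hi i) h2).toLinearMap

/-- `𝒞_k(V)`: the space at `k` is replaced by the colimit, with its injections from the spaces
at `k - 1` and `k + 1`. -/
def Mod.reflectColim (V : Mod F τ) (k : Fin n) (e : Dir) : Mod F (introvert k τ) where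
  space := replace V.space k (ModuleCat.of F (V.colim k e))
  finite := replace_finite _ _ _ V.finite (inferInstanceAs (Module.Finite F (V.colim k e)))
  fwd i h :=
    if h2 : hi i = k then
      (replaceAt V.space k _ (hi i) h2).symm.toLinearMap ∘ₗ
        V.colimInj k e (nbhdLo (.inr h2)) ∘ₗ
          (replaceAway V.space k _ (lo i) (of_introvert_right h).1).toLinearMap
    else
      (replaceAway V.space k _ (hi i) h2).symm.toLinearMap ∘ₗ
        V.fwd i ((of_introvert_right h).2 h2) ∘ₗ
          (replaceAway V.space k _ (lo i) (of_introvert_right h).1).toLinearMap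
  bwd i h :=
    if h1 : lo i = k then
      (replaceAt V.space k _ (lo i) h1).symm.toLinearMap ∘ₗ
        V.colimInj k e (nbhdHi (.inl h1)) ∘ₗ
          (replaceAway V.space k _ (hi i) (fun h2 => lo_ne_hi i (h1.trans h2.symm))).toLinearMap
    else
      (replaceAway V.space k _ (lo i) h1).symm.toLinearMap ∘ₗ
        V.bwd i (of_introvert_left h h1).2 ∘ₗ
          (replaceAway V.space k _ (hi i) (of_introvert_left h h1).1).toLinearMap

/-- The reflections: `ℒ_k` and `𝒞_k`. The direction `e` is the superscript of
`ℒ_1^e, 𝒞_1^e, ℒ_n^e, 𝒞_n^e`; it has no effect at the inner positions. -/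
inductive Reflection (n : ℕ)
  | lim (k : Fin n) (e : Dir)
  | colim (k : Fin n) (e : Dir)

/-- The effect of a reflection on types. -/
def Reflection.onType (r : Reflection n) (τ : ZType n) : ZType n :=
  match r with
  | .lim k _ => extrovert k τ
  | .colim k _ => introvert k τ

/-- The effect of a reflection on zigzag modules. -/
def Reflection.onMod (r : Reflection n) (V : Mod F τ) : Mod F (r.onType τ) :=
  match r with
  | .lim k e => V.reflectLim k e
  | .colim k e => V.reflectColim k e

/-! ### The reflection distance -/

/-- The effect on types of a sequence of reflections, applied from the head of the list on. -/
def seqType : List (Reflection n) → ZType n → ZType n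
  | [], τ => τ
  | r :: R, τ => seqType R (r.onType τ)

/-- `(𝒮 ∘ ℛ_ℓ ∘ 𝒮 ∘ ⋯ ∘ 𝒮 ∘ ℛ_1 ∘ 𝒮)(V)` for the sequence of reflections
`[ℛ_1, …, ℛ_ℓ]`. -/
def seqMod : (R : List (Reflection n)) → {τ : ZType n} → Mod F τ → Mod F (seqType R τ)
  | [], _, V => V.removeSimple
  | r :: R, _, V => seqMod R (r.onMod V.removeSimple)

/-- The `p`-cost of a sequence of reflections. -/
def cost (p : ℝ) (R : List (Reflection n)) : ℝ :=
  if R = [] then 0 else (R.length : ℝ) ^ (1 / p)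

/-- The `p`-reflection distance. -/
def reflectionDist (p : ℝ) (V : Mod F τ) (W : Mod F τ') : ℝ≥0∞ :=
  ⨅ (R : List (Reflection n)) (R' : List (Reflection n))
    (_ : Precsim (seqMod R V) W ∧ Precsim (seqMod R' W) V),
    ENNReal.ofReal (max (cost p R) (cost p R'))

/-! ### The bottleneck distance -/

/-- Matchings between two sets. -/
structure Matching (S T : Type*) where
  rel : S → T → Prop
  right_unique : ∀ s t t', rel s t → rel s t' → t = t'
  left_unique : ∀ s s' t, rel s t → rel s' t → s = s'

/-- `|r_y - r_x| / 2^(1 - 1/p)`. -/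
def diagCost (p : ℝ≥0∞) (r : ℝ × ℝ) : ℝ := |r.2 - r.1| / 2 ^ (1 - (1 / p).toReal)

/-- The cost `c_p(M)` of a matching between two multisets of points of the plane. -/
def Matching.cost (p : ℝ≥0∞) {S T : Multiset (ℝ × ℝ)} (M : Matching S.ToType T.ToType) : ℝ≥0∞ :=
  (⨆ (s : S.ToType) (t : T.ToType) (_ : M.rel s t),
      ENNReal.ofReal ‖WithLp.toLp p (s.1 - t.1)‖) ⊔
    ((⨆ (s : S.ToType) (_ : ∀ t, ¬ M.rel s t), ENNReal.ofReal (diagCost p s.1)) ⊔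
      (⨆ (t : T.ToType) (_ : ∀ s, ¬ M.rel s t), ENNReal.ofReal (diagCost p t.1)))

/-- The `ℓ^p`-bottleneck distance; for `p = ∞` this is the standard bottleneck distance. -/
def bottleneckDist (p : ℝ≥0∞) (S T : Multiset (ℝ × ℝ)) : ℝ≥0∞ :=
  ⨅ M : Matching S.ToType T.ToType, M.cost p

end

end Zigzag

/-! Two vectors at positions `b ≤ d` are linked if they extend to a family compatible with all
arrows between them. This is a linear relation, and its rank (`Mod.rank`) is the dimension of its
image modulo its indeterminacy. The rank ignores reversal of isomorphisms, is additive, and equals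
one or zero on an interval module, according to whether the interval contains both positions. So it
counts the intervals containing both, and these counts determine the diagram, even across different
types (`Mod.dgm_eq_of_rank_eq`). Decompositions exist because a nonzero vector at the first nonzero
position can be pushed to the right until an interval splits off (`Mod.exists_iso_intervalSum`).

Lower bound. Replacing the space at `k` by a limit or colimit does not change the links between
positions other than `k` (`Reflection.rank_onMod`), hence not the multiset of nonempty traces `I \
{k}`. Without simple summands every trace is nonempty, so one reflection moves each end point by at
most one, up to simple intervals `[k,k]` that appear. After `ℓ` reflections every surviving interval
has moved by at most `ℓ`, and every lost one had its ends at most `2ℓ` apart, which is diagonal cost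
at most `ℓ` (`dgm_seqMod`). Each of the two sequences in the definition of the distance thus gives a
matching that controls the unmatched points of one diagram only; Mendelsohn-Dulmage
(`Matching.exists_union`) merges the two into one that controls both.

Upper bound. Diagram points are integral. If the bottleneck distance is below `1/2`, the diagrams
agree off the diagonal and empty sequences show that the reflection distance is zero. Otherwise it
suffices that one fixed sequence of `2n` reflections annihilates every module: `n` colimits turn all
arrows to the right, then `n` limits erase the spaces from left to right
(`reflectionDist_le_two_mul`). This also gives finiteness, and `2n = 4n · 1/2` with `4n ≤ 2n²(n+1)`
gives the constant. -/

namespace Zigzag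

variable {n : ℕ} {F : Type u} [Field F] {τ τ' : ZType n}

/-! ### Compatible families and ranks -/

/-- The vectors `x` and `y` at the two ends of the `i`-th arrow are related by the `i`-th
structure map. -/
def Mod.Compat (V : Mod F τ) (i : Fin (n - 1)) (x : V.space (lo i)) (y : V.space (hi i)) : Prop :=
  (∀ h, V.fwd i h x = y) ∧ (∀ h, V.bwd i h y = x)

theorem Mod.compat_right (V : Mod F τ) {i : Fin (n - 1)} (h : τ i = .right) {x y} :
    V.Compat i x y ↔ V.fwd i h x = y :=
  ⟨fun H => H.1 h, fun H => ⟨fun _ => H, fun h' => by simp [h] at h'⟩⟩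

theorem Mod.compat_left (V : Mod F τ) {i : Fin (n - 1)} (h : τ i = .left) {x y} :
    V.Compat i x y ↔ V.bwd i h y = x :=
  ⟨fun H => H.2 h, fun H => ⟨fun h' => by simp [h] at h', fun _ => H⟩⟩

theorem Mod.compat_zero (V : Mod F τ) (i : Fin (n - 1)) : V.Compat i 0 0 :=
  ⟨fun _ => map_zero _, fun _ => map_zero _⟩

theorem Mod.Compat.add {V : Mod F τ} {i : Fin (n - 1)} {x y x' y'} (h : V.Compat i x y)
    (h' : V.Compat i x' y') : V.Compat i (x + x') (y + y') :=
  ⟨fun e => by rw [map_add, h.1, h'.1], fun e => by rw [map_add, h.2, h'.2]⟩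

theorem Mod.Compat.smul {V : Mod F τ} {i : Fin (n - 1)} {x y} (c : F) (h : V.Compat i x y) :
    V.Compat i (c • x) (c • y) :=
  ⟨fun e => by rw [map_smul, h.1], fun e => by rw [map_smul, h.2]⟩

/-- The families of vectors that are compatible with the structure maps between the positions
`b` and `d`. -/
def Mod.sections (V : Mod F τ) (b d : Fin n) : Submodule F (∀ i, V.space i) where
  carrier := {x | ∀ i, b ≤ lo i → hi i ≤ d → V.Compat i (x (lo i)) (x (hi i))}
  zero_mem' _ _ _ := V.compat_zero _
  add_mem' hx hy i h1 h2 := (hx i h1 h2).add (hy i h1 h2)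
  smul_mem' c _ hx i h1 h2 := (hx i h1 h2).smul c

/-- The linear relation between the spaces at `b` and `d` given by compatible families. -/
def Mod.link (V : Mod F τ) (b d : Fin n) : Submodule F (V.space b × V.space d) :=
  (V.sections b d).map ((LinearMap.proj b).prod (LinearMap.proj d))

theorem Mod.mem_link {V : Mod F τ} {b d : Fin n} {p : V.space b × V.space d} :
    p ∈ V.link b d ↔ ∃ x ∈ V.sections b d, x b = p.1 ∧ x d = p.2 := by
  simp [Mod.link, Prod.ext_iff]

/-- The vectors at `d` that are related to some vector at `b`. -/
def Mod.image (V : Mod F τ) (b d : Fin n) : Submodule F (V.space d) :=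
  (V.link b d).map (LinearMap.snd F _ _)

/-- The vectors at `d` that are related to zero at `b`. -/
def Mod.indet (V : Mod F τ) (b d : Fin n) : Submodule F (V.space d) :=
  (V.link b d).comap (LinearMap.inr F _ _)

theorem Mod.mem_image {V : Mod F τ} {b d : Fin n} {z : V.space d} :
    z ∈ V.image b d ↔ ∃ x, (x, z) ∈ V.link b d := by
  simp [Mod.image]

theorem Mod.mem_indet {V : Mod F τ} {b d : Fin n} {z : V.space d} :
    z ∈ V.indet b d ↔ (0, z) ∈ V.link b d := by
  simp [Mod.indet]

theorem Mod.indet_le_image (V : Mod F τ) (b d : Fin n) : V.indet b d ≤ V.image b d :=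
  fun _ hz => Mod.mem_image.2 ⟨0, Mod.mem_indet.1 hz⟩

/-- The rank of the linear relation between the spaces at `b` and `d`. -/
noncomputable def Mod.rank (V : Mod F τ) (b d : Fin n) : ℕ :=
  Module.finrank F (V.image b d) - Module.finrank F (V.indet b d)

theorem Mod.rank_eq_of_equiv {V : Mod F τ} {W : Mod F τ'} {b d : Fin n}
    (eb : V.space b ≃ₗ[F] W.space b) (ed : V.space d ≃ₗ[F] W.space d)
    (h : ∀ x z, (x, z) ∈ V.link b d ↔ (eb x, ed z) ∈ W.link b d) :
    V.rank b d = W.rank b d := by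
  have h1 : (V.image b d).map ed.toLinearMap = W.image b d := by
    ext z
    simp only [Submodule.mem_map, Mod.mem_image]
    constructor
    · rintro ⟨y, ⟨x, hx⟩, rfl⟩
      exact ⟨eb x, (h _ _).1 hx⟩
    · rintro ⟨x, hx⟩
      exact ⟨ed.symm z, ⟨eb.symm x, (h _ _).2 (by simpa using hx)⟩, by simp⟩
  have h2 : (V.indet b d).map ed.toLinearMap = W.indet b d := by
    ext z
    simp only [Submodule.mem_map, Mod.mem_indet]
    constructor
    · rintro ⟨y, hx, rfl⟩
      simpa using (h _ _).1 hx
    · intro hx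
      exact ⟨ed.symm z, (h _ _).2 (by simpa using hx), by simp⟩
  rw [Mod.rank, Mod.rank, ← h1, ← h2, LinearEquiv.finrank_map_eq, LinearEquiv.finrank_map_eq]

/-! ### Isomorphisms -/

theorem Mod.Iso.refl (V : Mod F τ) : V.Iso V :=
  ⟨fun _ => LinearEquiv.refl F _, fun _ _ _ => rfl, fun _ _ _ => rfl⟩

theorem Mod.Iso.symm {V W : Mod F τ} : V.Iso W → W.Iso V := by
  rintro ⟨φ, h1, h2⟩
  refine ⟨fun i => (φ i).symm, fun i h x => ?_, fun i h x => ?_⟩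
  · rw [LinearEquiv.symm_apply_eq, h1, LinearEquiv.apply_symm_apply]
  · rw [LinearEquiv.symm_apply_eq, h2, LinearEquiv.apply_symm_apply]

theorem Mod.Iso.trans {U V W : Mod F τ} : U.Iso V → V.Iso W → U.Iso W := by
  rintro ⟨φ, h1, h2⟩ ⟨ψ, g1, g2⟩
  refine ⟨fun i => (φ i).trans (ψ i), fun i h x => ?_, fun i h x => ?_⟩
  · simp only [LinearEquiv.trans_apply, h1, g1]
  · simp only [LinearEquiv.trans_apply, h2, g2]

theorem Mod.Iso.sum_congr {V V' W W' : Mod F τ} :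
    V.Iso V' → W.Iso W' → (V.sum W).Iso (V'.sum W') := by
  rintro ⟨φ, h1, h2⟩ ⟨ψ, g1, g2⟩
  exact ⟨fun i => (φ i).prodCongr (ψ i), fun i h x => Prod.ext (h1 i h x.1) (g1 i h x.2),
    fun i h x => Prod.ext (h2 i h x.1) (g2 i h x.2)⟩

theorem Mod.rank_eq_of_iso {V W : Mod F τ} (h : V.Iso W) (b d : Fin n) :
    V.rank b d = W.rank b d := by
  suffices key : ∀ {V W : Mod F τ} (φ : ∀ i, V.space i ≃ₗ[F] W.space i),
      (∀ i h x, φ (hi i) (V.fwd i h x) = W.fwd i h (φ (lo i) x)) →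
      (∀ i h x, φ (lo i) (V.bwd i h x) = W.bwd i h (φ (hi i) x)) →
      ∀ x z, (x, z) ∈ V.link b d → (φ b x, φ d z) ∈ W.link b d by
    obtain ⟨φ, h1, h2⟩ := h
    refine Mod.rank_eq_of_equiv (φ b) (φ d) fun x z => ⟨key φ h1 h2 x z, fun H => ?_⟩
    have := key (fun i => (φ i).symm)
      (fun i h x => by rw [LinearEquiv.symm_apply_eq, h1, LinearEquiv.apply_symm_apply])
      (fun i h x => by rw [LinearEquiv.symm_apply_eq, h2, LinearEquiv.apply_symm_apply]) _ _ H
    simpa using this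
  intro V W φ h1 h2 x z
  rw [Mod.mem_link, Mod.mem_link]
  rintro ⟨s, hs, rfl, rfl⟩
  refine ⟨fun i => φ i (s i), fun i hb hd => ⟨fun h => ?_, fun h => ?_⟩, rfl, rfl⟩
  · rw [← h1, (hs i hb hd).1]
  · rw [← h2, (hs i hb hd).2]

/-! ### Arrow reversals -/

/-- An isomorphism and its inverse have the same graph. This is why ranks are built from relations
and not from composites of maps. -/
theorem Mod.compat_reverse {V : Mod F τ} {k : Fin (n - 1)} (hk : V.IsIsoAt k) (i : Fin (n - 1))
    (x : V.space (lo i)) (y : V.space (hi i)) :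
    (V.reverse k hk).Compat i x y ↔ V.Compat i x y := by
  by_cases hik : i = k
  · subst hik
    cases h : τ i
    · have h' : reverseAt i τ i = .left := by simp [reverseAt, h, Dir.flip]
      refine (Mod.compat_left _ h').trans (Iff.trans ?_ (Mod.compat_right _ h).symm)
      simp only [Mod.reverse, dite_true]
      exact (LinearEquiv.symm_apply_eq _).trans eq_comm
    · have h' : reverseAt i τ i = .right := by simp [reverseAt, h, Dir.flip]
      refine (Mod.compat_right _ h').trans (Iff.trans ?_ (Mod.compat_left _ h).symm)
      simp only [Mod.reverse, dite_true]
      exact (LinearEquiv.symm_apply_eq _).trans eq_comm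
  · have h' : reverseAt k τ i = τ i := by simp [reverseAt, hik]
    cases h : τ i
    · refine (Mod.compat_right _ (h'.trans h)).trans (Iff.trans ?_ (Mod.compat_right _ h).symm)
      simp only [Mod.reverse, hik, dite_false]
      rfl
    · refine (Mod.compat_left _ (h'.trans h)).trans (Iff.trans ?_ (Mod.compat_left _ h).symm)
      simp only [Mod.reverse, hik, dite_false]
      rfl

theorem Mod.rank_reverse (V : Mod F τ) {k : Fin (n - 1)} (hk : V.IsIsoAt k) (b d : Fin n) :
    (V.reverse k hk).rank b d = V.rank b d := by
  refine Mod.rank_eq_of_equiv (LinearEquiv.refl F (V.space b)) (LinearEquiv.refl F (V.space d))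
    fun x z => ?_
  rw [Mod.mem_link, Mod.mem_link]
  have : ∀ s : ∀ i, V.space i, s ∈ (V.reverse k hk).sections b d ↔ s ∈ V.sections b d := fun s =>
    forall_congr' fun i => forall_congr' fun _ => forall_congr' fun _ =>
      Mod.compat_reverse hk i _ _
  exact exists_congr fun s => and_congr (this s) Iff.rfl

theorem Sim.rank_eq {V : Mod F τ} {W : Mod F τ'} (h : Sim V W) (b d : Fin n) :
    V.rank b d = W.rank b d := by
  induction h with
  | iso h => exact Mod.rank_eq_of_iso h b d
  | reverse k hk _ ih => rw [← ih, Mod.rank_reverse]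

/-! ### Ranks of direct sums -/

theorem Mod.mem_link_sum {V W : Mod F τ} {b d : Fin n} {x : V.space b} {x' : W.space b}
    {z : V.space d} {z' : W.space d} :
    (((x, x'), (z, z')) : (V.sum W).space b × (V.sum W).space d) ∈ (V.sum W).link b d ↔
      (x, z) ∈ V.link b d ∧ (x', z') ∈ W.link b d := by
  simp only [Mod.mem_link]
  constructor
  · rintro ⟨s, hs, h1, h2⟩
    exact ⟨⟨fun i => (s i).1, fun i hb hd => ⟨fun h => congrArg Prod.fst ((hs i hb hd).1 h),
        fun h => congrArg Prod.fst ((hs i hb hd).2 h)⟩, congrArg Prod.fst h1, congrArg Prod.fst h2⟩,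
      ⟨fun i => (s i).2, fun i hb hd => ⟨fun h => congrArg Prod.snd ((hs i hb hd).1 h),
        fun h => congrArg Prod.snd ((hs i hb hd).2 h)⟩, congrArg Prod.snd h1, congrArg Prod.snd h2⟩⟩
  · rintro ⟨⟨s, hs, h1, h2⟩, ⟨s', hs', h1', h2'⟩⟩
    exact ⟨fun i => (s i, s' i), fun i hb hd =>
      ⟨fun h => Prod.ext ((hs i hb hd).1 h) ((hs' i hb hd).1 h),
        fun h => Prod.ext ((hs i hb hd).2 h) ((hs' i hb hd).2 h)⟩, Prod.ext h1 h1', Prod.ext h2 h2'⟩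

theorem Mod.rank_sum (V W : Mod F τ) (b d : Fin n) :
    (V.sum W).rank b d = V.rank b d + W.rank b d := by
  have h1 : (V.sum W).image b d = (V.image b d).prod (W.image b d) := by
    ext ⟨z, z'⟩
    refine Mod.mem_image.trans (Iff.trans ?_ (Submodule.mem_prod (p := V.image b d)).symm)
    rw [Mod.mem_image, Mod.mem_image]
    constructor
    · rintro ⟨⟨x, x'⟩, h⟩
      exact ⟨⟨x, (Mod.mem_link_sum.1 h).1⟩, ⟨x', (Mod.mem_link_sum.1 h).2⟩⟩
    · rintro ⟨⟨x, h⟩, ⟨x', h'⟩⟩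
      exact ⟨(x, x'), Mod.mem_link_sum.2 ⟨h, h'⟩⟩
  have h2 : (V.sum W).indet b d = (V.indet b d).prod (W.indet b d) := by
    ext ⟨z, z'⟩
    refine Mod.mem_indet.trans (Iff.trans ?_ (Submodule.mem_prod (p := V.indet b d)).symm)
    rw [Mod.mem_indet, Mod.mem_indet]
    exact Mod.mem_link_sum (x := 0) (x' := 0)
  have h3 : ∀ (p : Submodule F (V.space d)) (q : Submodule F (W.space d)),
      Module.finrank F (p.prod q) = Module.finrank F p + Module.finrank F q := fun p q => by
    rw [← Module.finrank_prod]
    refine LinearEquiv.finrank_eq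
      { toFun := fun x => (⟨x.1.1, x.2.1⟩, ⟨x.1.2, x.2.2⟩)
        map_add' := fun _ _ => rfl
        map_smul' := fun _ _ => rfl
        invFun := fun y => ⟨(y.1, y.2), y.1.2, y.2.2⟩
        left_inv := fun _ => rfl
        right_inv := fun _ => rfl }
  -- The rank is a truncated difference; these inclusions make the subtraction additive.
  have h4 := Submodule.finrank_mono (V.indet_le_image b d)
  have h5 := Submodule.finrank_mono (W.indet_le_image b d)
  have h6 : Module.finrank F ((V.sum W).image b d) = _ :=
    (congrArg (fun S : Submodule F (V.space d × W.space d) => Module.finrank F S) h1).trans (h3 _ _)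
  have h7 : Module.finrank F ((V.sum W).indet b d) = _ :=
    (congrArg (fun S : Submodule F (V.space d × W.space d) => Module.finrank F S) h2).trans (h3 _ _)
  rw [Mod.rank, h6, h7, Mod.rank, Mod.rank]
  omega

theorem Mod.mem_link_bigSum {ι : Type} [Fintype ι] {X : ι → Mod F τ} {b d : Fin n}
    {x : ∀ j, (X j).space b} {z : ∀ j, (X j).space d} :
    ((x, z) : (Mod.bigSum X).space b × (Mod.bigSum X).space d) ∈ (Mod.bigSum X).link b d ↔
      ∀ j, (x j, z j) ∈ (X j).link b d := by
  simp only [Mod.mem_link]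
  constructor
  · rintro ⟨s, hs, h1, h2⟩ j
    exact ⟨fun i => s i j, fun i hb hd => ⟨fun h => congrFun ((hs i hb hd).1 h) j,
      fun h => congrFun ((hs i hb hd).2 h) j⟩, congrFun h1 j, congrFun h2 j⟩
  · intro H
    choose s hs h1 h2 using H
    exact ⟨fun i j => s j i, fun i hb hd => ⟨fun h => funext fun j => (hs j i hb hd).1 h,
      fun h => funext fun j => (hs j i hb hd).2 h⟩, funext h1, funext h2⟩

theorem finrank_pi_submodule {ι : Type*} [Fintype ι] {M : ι → Type*} [∀ j, AddCommGroup (M j)]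
    [∀ j, Module F (M j)] [∀ j, Module.Finite F (M j)] (p : ∀ j, Submodule F (M j)) :
    Module.finrank F (Submodule.pi Set.univ p) = ∑ j, Module.finrank F (p j) := by
  rw [← Module.finrank_pi_fintype]
  refine LinearEquiv.finrank_eq
    { toFun := fun x j => ⟨x.1 j, x.2 j trivial⟩
      map_add' := fun _ _ => rfl
      map_smul' := fun _ _ => rfl
      invFun := fun y => ⟨fun j => y j, fun j _ => (y j).2⟩
      left_inv := fun _ => rfl
      right_inv := fun _ => rfl }

theorem Mod.rank_bigSum {ι : Type} [Fintype ι] (X : ι → Mod F τ) (b d : Fin n) :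
    (Mod.bigSum X).rank b d = ∑ j, (X j).rank b d := by
  have h1 : (Mod.bigSum X).image b d = Submodule.pi Set.univ fun j => (X j).image b d := by
    ext z
    refine Mod.mem_image.trans (Iff.trans ?_ (Submodule.mem_pi (p := fun j => (X j).image b d)).symm)
    simp only [Mod.mem_image]
    constructor
    · rintro ⟨x, h⟩ j _
      exact ⟨x j, Mod.mem_link_bigSum.1 h j⟩
    · intro H
      choose x hx using fun j => H j trivial
      exact ⟨x, Mod.mem_link_bigSum.2 hx⟩
  have h2 : (Mod.bigSum X).indet b d = Submodule.pi Set.univ fun j => (X j).indet b d := by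
    ext z
    refine Mod.mem_indet.trans (Iff.trans ?_ (Submodule.mem_pi (p := fun j => (X j).indet b d)).symm)
    simp only [Mod.mem_indet]
    exact (Mod.mem_link_bigSum (x := 0)).trans ⟨fun h j _ => h j, fun h j => h j trivial⟩
  have h6 : Module.finrank F ((Mod.bigSum X).image b d) = _ :=
    (congrArg (fun S : Submodule F (∀ j, (X j).space d) => Module.finrank F S) h1).trans
      (finrank_pi_submodule _)
  have h7 : Module.finrank F ((Mod.bigSum X).indet b d) = _ :=
    (congrArg (fun S : Submodule F (∀ j, (X j).space d) => Module.finrank F S) h2).trans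
      (finrank_pi_submodule _)
  rw [Mod.rank, h6, h7, ← Finset.sum_tsub_distrib]
  · rfl
  · exact fun j _ => Submodule.finrank_mono ((X j).indet_le_image b d)

/-! ### Ranks of interval modules -/

theorem Interval.mem_space_iff {I : Interval n} {i : Fin n} {c : F} :
    c ∈ I.space F i ↔ (¬ I.Mem i → c = 0) := by
  by_cases h : I.Mem i <;> simp [Interval.space, h]

theorem Interval.coe_map (I : Interval n) (i j : Fin n) (x : I.space F i) [Decidable (I.Mem j)] :
    (I.map F i j x : F) = if I.Mem j then (x : F) else 0 := by
  have hx := Interval.mem_space_iff.1 x.2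
  by_cases hi : I.Mem i <;> by_cases hj : I.Mem j <;> simp_all [Interval.map]

theorem Interval.mem_of_le_of_le {I : Interval n} {b i d : Fin n} (hb : I.Mem b) (hd : I.Mem d)
    (h1 : b ≤ i) (h2 : i ≤ d) : I.Mem i :=
  ⟨hb.1.trans h1, h2.trans hd.2⟩

theorem compat_intervalMod {I : Interval n} {i : Fin (n - 1)} (h1 : I.Mem (lo i))
    (h2 : I.Mem (hi i)) (x : I.space F (lo i)) (y : I.space F (hi i)) :
    (intervalMod F τ I).Compat i x y ↔ (x : F) = y := by
  classical
  cases h : τ i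
  · refine (Mod.compat_right _ h).trans (Subtype.ext_iff.trans ?_)
    rw [show ((intervalMod F τ I).fwd i h x : I.space F (hi i)) = I.map F (lo i) (hi i) x from rfl,
      Interval.coe_map, if_pos h2]
  · refine (Mod.compat_left _ h).trans (Subtype.ext_iff.trans ?_)
    rw [show ((intervalMod F τ I).bwd i h y : I.space F (lo i)) = I.map F (hi i) (lo i) y from rfl,
      Interval.coe_map, if_pos h1, eq_comm]

/-- If `I` contains both ends it contains all positions between them, where compatible families are
constant; so the link is the diagonal of `F`. If it misses one end, one of the two linked vectors is
zero and the image is all indeterminacy. -/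
theorem rank_intervalMod (I : Interval n) {b d : Fin n} (hbd : b ≤ d)
    [Decidable (I.Mem b ∧ I.Mem d)] :
    (intervalMod F τ I).rank b d = if I.Mem b ∧ I.Mem d then 1 else 0 := by
  split_ifs with h
  · obtain ⟨hb, hd⟩ := h
    have hmem : ∀ i, b ≤ i → i ≤ d → I.Mem i := fun i => Interval.mem_of_le_of_le hb hd
    have h1 : (intervalMod F τ I).image b d = ⊤ := by
      refine top_unique fun z _ => Mod.mem_image.2 ?_
      classical
      let s : ∀ i, I.space F i := fun i =>
        ⟨if I.Mem i then (show I.space F d from z).1 else 0, by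
          rw [Interval.mem_space_iff]; intro h; simp [h]⟩
      refine ⟨s b, Mod.mem_link.2 ⟨s, fun i h1 h2 => ?_, rfl, ?_⟩⟩
      · have h3 : lo i ≤ hi i := by simp [lo, hi]
        have m1 := hmem (lo i) h1 (h3.trans h2)
        have m2 := hmem (hi i) (h1.trans h3) h2
        refine (compat_intervalMod m1 m2 _ _).2 ?_
        simp [s, m1, m2]
      · refine Subtype.ext ?_
        simp [s, hd]
    have h2 : (intervalMod F τ I).indet b d = ⊥ := by
      refine bot_unique fun z hz => ?_
      obtain ⟨s, hs, h1, h2⟩ := Mod.mem_link.1 (Mod.mem_indet.1 hz)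
      change ∀ i, I.space F i at s
      -- A compatible family that vanishes at `b` stays zero, one arrow at a time, up to `d`.
      have key : ∀ (k : ℕ) (h : k < n), b ≤ ⟨k, h⟩ → (⟨k, h⟩ : Fin n) ≤ d → (s ⟨k, h⟩ : F) = 0 := by
        intro k
        induction k with
        | zero =>
          intro h hb hd
          have : b = ⟨0, h⟩ := le_antisymm hb (by simp [Fin.le_def])
          subst this
          exact congrArg Subtype.val h1
        | succ k ih =>
          intro h hbk hdk
          rcases eq_or_lt_of_le hbk with rfl | hlt
          · exact congrArg Subtype.val h1
          · have hle : b ≤ ⟨k, by omega⟩ := by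
              simp only [Fin.lt_def, Fin.le_def] at *; omega
            have hle' : (⟨k, by omega⟩ : Fin n) ≤ d := by
              simp only [Fin.lt_def, Fin.le_def] at *; omega
            have := hs ⟨k, by omega⟩ hle hdk
            rw [← ih (by omega) hle hle']
            exact ((compat_intervalMod (i := ⟨k, by omega⟩) (hmem _ hle hle') (hmem _ hbk hdk)
              _ _).1 this).symm
      exact (Submodule.mem_bot F).2 (h2.symm.trans (Subtype.ext (key d d.2 hbd le_rfl)))
    have h3 : Module.finrank F (I.space F d) = 1 := by
      rw [Interval.space, if_pos hd, finrank_top, Module.finrank_self]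
    rw [Mod.rank, h1, h2, finrank_top, finrank_bot]
    exact h3
  · have : (intervalMod F τ I).image b d ≤ (intervalMod F τ I).indet b d := by
      intro z hz
      obtain ⟨x, hx⟩ := Mod.mem_image.1 hz
      rw [Mod.mem_indet]
      by_cases hb : I.Mem b
      · have hd : ¬ I.Mem d := fun hd => h ⟨hb, hd⟩
        have : z = 0 := Subtype.ext (Interval.mem_space_iff.1 (show I.space F d from z).2 hd)
        rw [this]
        exact zero_mem _
      · have : x = 0 := Subtype.ext (Interval.mem_space_iff.1 (show I.space F b from x).2 hb)
        rwa [this] at hx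
    exact Nat.sub_eq_zero_of_le (Submodule.finrank_mono this)

theorem rank_intervalSum (D : Multiset (Interval n)) {b d : Fin n} (hbd : b ≤ d)
    [DecidablePred fun I : Interval n => I.Mem b ∧ I.Mem d] :
    (intervalSum F τ D).rank b d = D.countP fun I => I.Mem b ∧ I.Mem d := by
  rw [intervalSum, Mod.rank_bigSum]
  simp only [rank_intervalMod _ hbd]
  conv_rhs => rw [← Multiset.map_univ_coe D, Multiset.countP_map]
  rw [Finset.sum_boole]
  simp [Finset.card_def]

/-! ### Multisets of intervals are determined by their ranks -/

/-- Möbius inversion: the supersets of `T` are the copies of `T` and the strict supersets, and the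
latter are settled by induction on the size of the complement. The hypothesis is asked only of sets
that occur in `A` or `B`, because only traces of intervals can be tested by a pair of positions. -/
theorem count_eq_of_countP_subset_eq {α : Type*} [DecidableEq α] [Fintype α]
    (A B : Multiset (Finset α))
    (h : ∀ T : Finset α, T.Nonempty → T ∈ A ∨ T ∈ B → A.countP (T ⊆ ·) = B.countP (T ⊆ ·))
    (T : Finset α) (hT : T.Nonempty) : A.count T = B.count T := by
  induction hm : Fintype.card α - T.card using Nat.strong_induction_on generalizing T with
  | _ m ih =>
    have split : ∀ C : Multiset (Finset α), C.countP (T ⊆ ·) = C.count T + C.countP (T ⊂ ·) := by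
      intro C
      induction C using Multiset.induction_on with
      | empty => simp
      | cons a C ihC =>
        rw [Multiset.countP_cons, Multiset.countP_cons, Multiset.count_cons, ihC]
        by_cases h1 : T = a
        · subst h1
          simp only [subset_refl, ssubset_irrefl, if_true, if_false]
          omega
        · by_cases h2 : T ⊆ a
          · simp only [h1, h2, h2.ssubset_of_ne h1, if_true, if_false]
            omega
          · have h3 : ¬ T ⊂ a := fun h => h2 h.1
            simp only [h1, h2, h3, if_false]
            omega
    by_cases hmem : T ∈ A ∨ T ∈ B
    · have h1 := h T hT hmem
      have h2 : A.filter (T ⊂ ·) = B.filter (T ⊂ ·) := by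
        ext T'
        rw [Multiset.count_filter, Multiset.count_filter]
        split_ifs with hlt
        · have h3 := Finset.card_lt_card hlt
          have h4 := Finset.card_le_univ T'
          exact ih _ (by omega) T' (hT.mono hlt.1) rfl
        · rfl
      rw [split, split, Multiset.countP_eq_card_filter, Multiset.countP_eq_card_filter, h2] at h1
      omega
    · rw [not_or] at hmem
      rw [Multiset.count_eq_zero_of_notMem hmem.1, Multiset.count_eq_zero_of_notMem hmem.2]

open Classical in
/-- The positions in `[b, d]` that satisfy `P`. -/
noncomputable def Interval.trace (P : Fin n → Prop) (I : Interval n) : Finset (Fin n) :=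
  Finset.univ.filter fun i => I.Mem i ∧ P i

theorem Interval.mem_trace {P : Fin n → Prop} {I : Interval n} {i : Fin n} :
    i ∈ I.trace P ↔ I.Mem i ∧ P i := by
  simp [Interval.trace]

/-- Take the least and the greatest element of the trace: an interval that contains both contains
everything between. -/
theorem exists_subset_trace_iff {P : Fin n → Prop} {I : Interval n} (h : (I.trace P).Nonempty) :
    ∃ b d : Fin n, b ≤ d ∧ P b ∧ P d ∧
      ∀ J : Interval n, I.trace P ⊆ J.trace P ↔ J.Mem b ∧ J.Mem d := by
  have hb := Interval.mem_trace.1 ((I.trace P).min'_mem h)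
  have hd := Interval.mem_trace.1 ((I.trace P).max'_mem h)
  refine ⟨_, _, (I.trace P).min'_le_max' h, hb.2, hd.2, fun J => ⟨fun H => ?_, fun H i hi => ?_⟩⟩
  · exact ⟨(Interval.mem_trace.1 (H ((I.trace P).min'_mem h))).1,
      (Interval.mem_trace.1 (H ((I.trace P).max'_mem h))).1⟩
  · exact Interval.mem_trace.2 ⟨Interval.mem_of_le_of_le H.1 H.2 (Finset.min'_le _ _ hi)
      (Finset.le_max' _ _ hi), (Interval.mem_trace.1 hi).2⟩

-- With `P` always true this yields uniqueness of the diagram; with `P` the condition `≠ k` it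
-- compares a module with its reflection at `k`.
open Classical in
theorem count_trace_eq (P : Fin n → Prop) {D E : Multiset (Interval n)}
    (h : ∀ b d, b ≤ d → P b → P d →
      D.countP (fun I => I.Mem b ∧ I.Mem d) = E.countP (fun I => I.Mem b ∧ I.Mem d))
    {T : Finset (Fin n)} (hT : T.Nonempty) :
    (D.map (Interval.trace P)).count T = (E.map (Interval.trace P)).count T := by
  refine count_eq_of_countP_subset_eq _ _ (fun T hT hmem => ?_) T hT
  obtain ⟨I, rfl⟩ : ∃ I : Interval n, I.trace P = T := by
    rcases hmem with hmem | hmem <;> obtain ⟨I, _, hI⟩ := Multiset.mem_map.1 hmem <;>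
      exact ⟨I, hI⟩
  obtain ⟨b, d, hbd, hb, hd, H⟩ := exists_subset_trace_iff hT
  simp only [Multiset.countP_map, H, ← Multiset.countP_eq_card_filter]
  exact h b d hbd hb hd

theorem Interval.self_mem_left (I : Interval n) : I.Mem I.1.1 := ⟨le_rfl, I.2⟩

theorem Interval.self_mem_right (I : Interval n) : I.Mem I.1.2 := ⟨I.2, le_rfl⟩

theorem Interval.trace_injective : Function.Injective (Interval.trace (n := n) fun _ => True) := by
  intro I J h
  have H : ∀ i, I.Mem i ↔ J.Mem i := fun i => by
    simpa [Interval.mem_trace] using Finset.ext_iff.1 h i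
  have h1 := (H _).1 I.self_mem_left
  have h2 := (H _).1 I.self_mem_right
  have h3 := (H _).2 J.self_mem_left
  have h4 := (H _).2 J.self_mem_right
  exact Subtype.ext (Prod.ext (le_antisymm h3.1 h1.1) (le_antisymm h2.2 h4.2))

open Classical in
theorem multiset_interval_ext {D E : Multiset (Interval n)}
    (h : ∀ b d, b ≤ d →
      D.countP (fun I => I.Mem b ∧ I.Mem d) = E.countP (fun I => I.Mem b ∧ I.Mem d)) : D = E := by
  refine Multiset.map_injective Interval.trace_injective (Multiset.ext.2 fun T => ?_)
  rcases T.eq_empty_or_nonempty with rfl | hT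
  · have : ∀ D : Multiset (Interval n), ∅ ∉ D.map (Interval.trace fun _ => True) := by
      intro D hD
      obtain ⟨I, _, hI⟩ := Multiset.mem_map.1 hD
      have := Interval.mem_trace (P := fun _ => True).2 ⟨I.self_mem_left, trivial⟩
      rw [hI] at this
      simp at this
    rw [Multiset.count_eq_zero_of_notMem (this D), Multiset.count_eq_zero_of_notMem (this E)]
  · exact count_trace_eq _ (fun b d hbd _ _ => h b d hbd) hT

/-! ### Compatible families along one more arrow -/

theorem lo_lt_hi (i : Fin (n - 1)) : lo i < hi i := by simp [lo, hi]

theorem lo_injective : Function.Injective (lo (n := n)) := fun i j h => by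
  simpa [lo, Fin.ext_iff] using h

theorem hi_injective : Function.Injective (hi (n := n)) := fun i j h => by
  simpa [hi, Fin.ext_iff] using h

theorem le_lo_of_lt_hi {i : Fin (n - 1)} {b : Fin n} (h : b < hi i) : b ≤ lo i := by
  simp only [hi, lo, Fin.lt_def, Fin.le_def] at *
  omega

theorem hi_le_of_lo_lt {i : Fin (n - 1)} {b : Fin n} (h : lo i < b) : hi i ≤ b := by
  simp only [hi, lo, Fin.lt_def, Fin.le_def] at *
  omega

theorem exists_hi_eq {b d : Fin n} (h : b < d) : ∃ i, hi i = d :=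
  ⟨⟨d - 1, by simp only [Fin.lt_def] at h; omega⟩, by
    simp only [Fin.lt_def] at h; simp only [hi, Fin.ext_iff]; omega⟩

theorem exists_lo_eq {d b : Fin n} (h : d < b) : ∃ i, lo i = d :=
  ⟨⟨d, by simp only [Fin.lt_def] at h; omega⟩, rfl⟩

/-- Links compose. Since `Mod.sections` imposes nothing outside `[b, d]`, a family compatible up to
`lo i` may be overwritten at `hi i`. -/
theorem Mod.link_hi {V : Mod F τ} {i : Fin (n - 1)} {b : Fin n} (hb : b ≤ lo i) {x z} :
    (x, z) ∈ V.link b (hi i) ↔ ∃ y, (x, y) ∈ V.link b (lo i) ∧ V.Compat i y z := by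
  simp only [Mod.mem_link]
  constructor
  · rintro ⟨s, hs, rfl, rfl⟩
    exact ⟨_, ⟨s, fun j h1 h2 => hs j h1 (h2.trans (lo_lt_hi i).le), rfl, rfl⟩, hs i hb le_rfl⟩
  · rintro ⟨_, ⟨s, hs, rfl, rfl⟩, hc⟩
    refine ⟨Function.update s (hi i) z, fun j h1 h2 => ?_, ?_, by simp⟩
    · have hlo : lo j ≠ hi i := ((lo_lt_hi j).trans_le h2).ne
      by_cases hij : j = i
      · subst hij
        simpa [Function.update_of_ne hlo] using hc
      · have hhi : hi j ≠ hi i := fun h => hij (hi_injective h)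
        rw [Function.update_of_ne hlo, Function.update_of_ne hhi]
        exact hs j h1 (le_lo_of_lt_hi (lt_of_le_of_ne h2 hhi))
    · exact Function.update_of_ne (hb.trans_lt (lo_lt_hi i)).ne _ _

theorem Mod.mem_image_hi {V : Mod F τ} {i : Fin (n - 1)} {b : Fin n} (hb : b ≤ lo i) {z} :
    z ∈ V.image b (hi i) ↔ ∃ y ∈ V.image b (lo i), V.Compat i y z := by
  simp only [Mod.mem_image, Mod.link_hi hb]
  exact ⟨fun ⟨x, y, h, h'⟩ => ⟨y, ⟨x, h⟩, h'⟩, fun ⟨y, ⟨x, h⟩, h'⟩ => ⟨x, y, h, h'⟩⟩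

theorem Mod.mem_indet_hi {V : Mod F τ} {i : Fin (n - 1)} {b : Fin n} (hb : b ≤ lo i) {z} :
    z ∈ V.indet b (hi i) ↔ ∃ y ∈ V.indet b (lo i), V.Compat i y z := by
  simp only [Mod.mem_indet, Mod.link_hi hb]

theorem Mod.mem_link_self {V : Mod F τ} {b : Fin n} {x z : V.space b} :
    (x, z) ∈ V.link b b ↔ x = z := by
  rw [Mod.mem_link]
  constructor
  · rintro ⟨s, _, rfl, rfl⟩
    rfl
  · rintro rfl
    exact ⟨Function.update 0 b x, fun i h1 h2 => absurd (lo_lt_hi i) (h2.trans h1).not_gt,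
      by simp, by simp⟩

theorem Mod.image_self (V : Mod F τ) (b : Fin n) : V.image b b = ⊤ :=
  top_unique fun z _ => Mod.mem_image.2 ⟨z, Mod.mem_link_self.2 rfl⟩

theorem Mod.indet_self (V : Mod F τ) (b : Fin n) : V.indet b b = ⊥ :=
  bot_unique fun _ hz => (Mod.mem_link_self.1 (Mod.mem_indet.1 hz)).symm

theorem Mod.rank_self (V : Mod F τ) (b : Fin n) : V.rank b b = Module.finrank F (V.space b) := by
  rw [Mod.rank, V.image_self, V.indet_self, finrank_top, finrank_bot, Nat.sub_zero]

/-! ### Splitting off an interval summand -/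

/-- The functional vanishes on the kernel of `A → B → B ⧸ K`, and over a field such functionals are
exactly those pulled back from `B ⧸ K`. -/
theorem exists_functional_extension {A B : Type*} [AddCommGroup A] [Module F A]
    [AddCommGroup B] [Module F B] (f : A →ₗ[F] B) (K : Submodule F B) (φ : A →ₗ[F] F)
    (h : K.comap f ≤ LinearMap.ker φ) : ∃ ψ : B →ₗ[F] F, ψ ∘ₗ f = φ ∧ K ≤ LinearMap.ker ψ := by
  have h1 : φ ∈ LinearMap.range (K.mkQ ∘ₗ f).dualMap := by
    rw [LinearMap.range_dualMap_eq_dualAnnihilator_ker, LinearMap.ker_comp, Submodule.ker_mkQ,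
      Submodule.mem_dualAnnihilator]
    exact fun x hx => h hx
  obtain ⟨ψ, rfl⟩ := h1
  refine ⟨ψ ∘ₗ K.mkQ, rfl, fun x hx => ?_⟩
  simp [(Submodule.Quotient.mk_eq_zero K).2 hx]

theorem exists_functional_of_notMem {B : Type*} [AddCommGroup B] [Module F B] (K : Submodule F B)
    {y : B} (hy : y ∉ K) : ∃ ψ : B →ₗ[F] F, ψ y = 1 ∧ K ≤ LinearMap.ker ψ := by
  obtain ⟨ψ, h1, h2⟩ := exists_functional_extension (LinearMap.toSpanSingleton F B y) K
    LinearMap.id (fun c hc => by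
      by_contra h
      have hc' : c ≠ 0 := h
      have : c⁻¹ • (c • y) ∈ K := K.smul_mem _ (by simpa using hc)
      rw [smul_smul, inv_mul_cancel₀ hc', one_smul] at this
      exact hy this)
  refine ⟨ψ, ?_, h2⟩
  simpa using LinearMap.congr_fun h1 1

/-- The functional is carried from `d` back to `b`: composed with an arrow to the right, extended
along an arrow to the left. Vanishing on the indeterminacy is what permits the extension, and it is
inherited at each step. -/
theorem Mod.exists_functionals (V : Mod F τ) (b d : Fin n) (hbd : b ≤ d) (φ : V.space d →ₗ[F] F)
    (hφ : V.indet b d ≤ LinearMap.ker φ) :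
    ∃ ψ : ∀ i, V.space i →ₗ[F] F, ψ d = φ ∧
      ∀ i, b ≤ lo i → hi i ≤ d → ∀ x y, V.Compat i x y → ψ (lo i) x = ψ (hi i) y := by
  induction hm : (d : ℕ) generalizing d with
  | zero =>
    refine ⟨Function.update 0 d φ, by simp, fun i _ h => absurd h ?_⟩
    simp [Fin.le_def, hm, hi]
  | succ m ih =>
    rcases hbd.eq_or_lt with rfl | hlt
    · exact ⟨Function.update 0 b φ, by simp,
        fun i h1 h2 => absurd (lo_lt_hi i) (h2.trans h1).not_gt⟩
    · obtain ⟨i, rfl⟩ := exists_hi_eq hlt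
      have hb := le_lo_of_lt_hi hlt
      obtain ⟨φ', h1, h2⟩ : ∃ φ' : V.space (lo i) →ₗ[F] F,
          V.indet b (lo i) ≤ LinearMap.ker φ' ∧ ∀ x y, V.Compat i x y → φ' x = φ y := by
        cases h : τ i
        · refine ⟨φ ∘ₗ V.fwd i h, fun x hx => ?_, fun x y hxy => ?_⟩
          · exact hφ ((Mod.mem_indet_hi hb).2 ⟨x, hx, (V.compat_right h).2 rfl⟩)
          · rw [← hxy.1 h]
            rfl
        · obtain ⟨ψ, h1, h2⟩ := exists_functional_extension (V.bwd i h) (V.indet b (lo i)) φ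
            (fun z hz => hφ ((Mod.mem_indet_hi hb).2 ⟨_, hz, (V.compat_left h).2 rfl⟩))
          refine ⟨ψ, h2, fun x y hxy => ?_⟩
          rw [← hxy.2 h, ← h1]
          rfl
      obtain ⟨ψ, rfl, hψ⟩ := ih (lo i) hb φ' h1 (by simpa [lo, hi] using hm)
      refine ⟨Function.update ψ (hi i) φ, by simp, fun j hbj hj x y hxy => ?_⟩
      have hlo : lo j ≠ hi i := ((lo_lt_hi j).trans_le hj).ne
      rw [Function.update_of_ne hlo]
      by_cases hij : j = i
      · subst hij
        rw [Function.update_self]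
        exact h2 x y hxy
      · have hhi : hi j ≠ hi i := fun h => hij (hi_injective h)
        rw [Function.update_of_ne hhi]
        exact hψ j hbj (le_lo_of_lt_hi (lt_of_le_of_ne hj hhi)) x y hxy

/-- The submodule of the `τ`-module `V` on a family of subspaces closed under the structure
maps. -/
def Mod.restrict (V : Mod F τ) (S : ∀ i, Submodule F (V.space i))
    (h1 : ∀ i h, ∀ x ∈ S (lo i), V.fwd i h x ∈ S (hi i))
    (h2 : ∀ i h, ∀ x ∈ S (hi i), V.bwd i h x ∈ S (lo i)) : Mod F τ where
  space i := ModuleCat.of F (S i)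
  finite i := inferInstanceAs (Module.Finite F (S i))
  fwd i h := (V.fwd i h).restrict (h1 i h)
  bwd i h := (V.bwd i h).restrict (h2 i h)

/-- The vectors `x i` embed the interval module, the functionals `φ i` retract onto it, and their
kernels form the complement. -/
theorem Mod.exists_iso_sum_of_retraction (V : Mod F τ) (I : Interval n) (x : ∀ i, V.space i)
    (φ : ∀ i, V.space i →ₗ[F] F) (hx : ∀ i, ¬ I.Mem i → x i = 0) (hφ : ∀ i, ¬ I.Mem i → φ i = 0)
    (h1 : ∀ i, I.Mem i → φ i (x i) = 1)
    (hx1 : ∀ i h, I.Mem (lo i) → V.fwd i h (x (lo i)) = x (hi i))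
    (hx2 : ∀ i h, I.Mem (hi i) → V.bwd i h (x (hi i)) = x (lo i))
    (hφ1 : ∀ i h, I.Mem (hi i) → φ (hi i) ∘ₗ V.fwd i h = φ (lo i))
    (hφ2 : ∀ i h, I.Mem (lo i) → φ (lo i) ∘ₗ V.bwd i h = φ (hi i)) :
    ∃ U : Mod F τ, V.Iso ((intervalMod F τ I).sum U) := by
  classical
  have c1 : ∀ i h, ∀ y ∈ LinearMap.ker (φ (lo i)), V.fwd i h y ∈ LinearMap.ker (φ (hi i)) := by
    intro i h y hy
    by_cases hI : I.Mem (hi i)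
    · rw [← hφ1 i h hI] at hy
      exact hy
    · simp [hφ _ hI]
  have c2 : ∀ i h, ∀ y ∈ LinearMap.ker (φ (hi i)), V.bwd i h y ∈ LinearMap.ker (φ (lo i)) := by
    intro i h y hy
    by_cases hI : I.Mem (lo i)
    · rw [← hφ2 i h hI] at hy
      exact hy
    · simp [hφ _ hI]
  refine ⟨V.restrict (fun i => LinearMap.ker (φ i)) c1 c2, Mod.Iso.symm ?_⟩
  have hc : ∀ i (c : I.space F i), (c : F) * φ i (x i) = c := by
    intro i c
    by_cases hI : I.Mem i
    · rw [h1 i hI, mul_one]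
    · rw [Interval.mem_space_iff.1 c.2 hI, zero_mul]
  let e : ∀ i, (I.space F i × LinearMap.ker (φ i)) ≃ₗ[F] V.space i := fun i =>
    { toFun := fun p => (p.1 : F) • x i + p.2
      map_add' := fun p q => by simp [add_smul]; abel
      map_smul' := fun c p => by simp [mul_smul]
      invFun := fun v => (⟨φ i v, Interval.mem_space_iff.2 fun h => by simp [hφ i h]⟩,
        ⟨v - φ i v • x i, by
          by_cases hI : I.Mem i
          · simp [h1 i hI]
          · simp [hφ i hI]⟩)
      left_inv := fun p => by
        have hp : φ i p.2 = 0 := p.2.2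
        ext <;> simp [hc, hp]
      right_inv := fun v => by simp }
  have key : ∀ i j (f : V.space i →ₗ[F] V.space j) (c : I.space F i)
      (_ : I.Mem i → f (x i) = x j), f ((c : F) • x i) = (I.map F i j c : F) • x j := by
    intro i j f c hf
    rw [Interval.coe_map]
    by_cases hi' : I.Mem i
    · rw [map_smul, hf hi']
      by_cases hj : I.Mem j
      · rw [if_pos hj]
      · rw [hx _ hj, smul_zero, smul_zero]
    · simp [Interval.mem_space_iff.1 c.2 hi']
  refine ⟨e, fun i h p => ?_, fun i h p => ?_⟩
  · change (I.map F (lo i) (hi i) p.1 : F) • x (hi i) + V.fwd i h p.2.1 =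
      V.fwd i h ((p.1.1 : F) • x (lo i) + p.2.1)
    exact ((map_add (V.fwd i h) _ _).trans
      (congrArg (· + V.fwd i h p.2.1) (key (lo i) (hi i) (V.fwd i h) p.1 (hx1 i h)))).symm
  · change (I.map F (hi i) (lo i) p.1 : F) • x (lo i) + V.bwd i h p.2.1 =
      V.bwd i h ((p.1.1 : F) • x (hi i) + p.2.1)
    exact ((map_add (V.bwd i h) _ _).trans
      (congrArg (· + V.bwd i h p.2.1) (key (hi i) (lo i) (V.bwd i h) p.1 (hx2 i h)))).symm

/-- A compatible family through `y`, paired with functionals extending `φ`, gives the retraction. On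
the left of `b` nothing can interfere since the spaces vanish; on the right of `d` the condition
`hend` cuts the interval off. -/
theorem Mod.exists_iso_sum_of_mem_image (V : Mod F τ) {b d : Fin n} (hbd : b ≤ d)
    (hb : ∀ i < b, Subsingleton (V.space i)) {y : V.space d} (hy : y ∈ V.image b d)
    {φ : V.space d →ₗ[F] F} (hφ : V.indet b d ≤ LinearMap.ker φ) (hφy : φ y = 1)
    (hend : ∀ i, ∀ e : lo i = d, (∀ h, V.fwd i h (e ▸ y) = 0) ∧
      ∀ h z, φ (e ▸ V.bwd i h z) = 0) :
    ∃ (I : Interval n) (U : Mod F τ), V.Iso ((intervalMod F τ I).sum U) := by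
  classical
  obtain ⟨x0, hx0⟩ := Mod.mem_image.1 hy
  obtain ⟨s, hs, -, rfl⟩ := Mod.mem_link.1 hx0
  obtain ⟨ψ, rfl, hψ⟩ := V.exists_functionals b d hbd φ hφ
  have hfwd : ∀ i, lo i = d → ∀ h, V.fwd i h (s (lo i)) = 0 := by
    rintro i rfl
    exact (hend i rfl).1
  have hbwd : ∀ i, lo i = d → ∀ h z, ψ (lo i) (V.bwd i h z) = 0 := by
    rintro i rfl
    exact (hend i rfl).2
  let I : Interval n := ⟨(b, d), hbd⟩
  have hI : ∀ i, I.Mem i ↔ b ≤ i ∧ i ≤ d := fun i => Iff.rfl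
  -- The pairing is constant along compatible arrows, so its value `1` at `d` propagates down to
  -- `b`; `k` is the distance to `d`.
  have hone : ∀ (k : ℕ) (i : Fin n), (i : ℕ) + k = d → b ≤ i → ψ i (s i) = 1 := by
    intro k
    induction k with
    | zero =>
      intro i hi' _
      obtain rfl : i = d := Fin.ext hi'
      exact hφy
    | succ k ih =>
      intro i hi' hbi
      obtain ⟨j, rfl⟩ : ∃ j, lo j = i := exists_lo_eq (b := d) (by simp only [Fin.lt_def]; omega)
      have hjd : hi j ≤ d := hi_le_of_lo_lt (by simp only [Fin.lt_def]; omega)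
      rw [hψ j hbi hjd _ _ (hs j hbi hjd)]
      exact ih (hi j) (by simp only [lo, hi] at *; omega) (hbi.trans (lo_lt_hi j).le)
  have caseHi : ∀ i, I.Mem (lo i) → ¬ I.Mem (hi i) → lo i = d := by
    intro i h1 h2
    refine le_antisymm h1.2 (not_lt.1 fun h => h2 ⟨h1.1.trans (lo_lt_hi i).le, hi_le_of_lo_lt h⟩)
  have caseLo : ∀ i, I.Mem (hi i) → ¬ I.Mem (lo i) → lo i < b := by
    intro i h1 h2
    exact not_le.1 fun h => h2 ⟨h, (lo_lt_hi i).le.trans h1.2⟩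
  refine ⟨I, V.exists_iso_sum_of_retraction I (fun i => if I.Mem i then s i else 0)
    (fun i => if I.Mem i then ψ i else 0) (fun i h => by simp [h]) (fun i h => by simp [h])
    (fun i h => ?_) (fun i h hm => ?_) (fun i h hm => ?_) (fun i h hm => ?_) (fun i h hm => ?_)⟩
  · simp only [if_pos h]
    exact hone (d - i) i (by have := h.2; simp only [I, Fin.le_def] at this; omega) h.1
  · rw [if_pos hm]
    split_ifs with h'
    · exact (hs i hm.1 h'.2).1 h
    · exact hfwd i (caseHi i hm h') h
  · rw [if_pos hm]
    split_ifs with h'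
    · exact (hs i h'.1 hm.2).2 h
    · have := hb _ (caseLo i hm h')
      exact Subsingleton.elim _ _
  · rw [if_pos hm]
    split_ifs with h'
    · ext z
      exact (hψ i h'.1 hm.2 _ _ ((V.compat_right h).2 rfl)).symm
    · have := hb _ (caseLo i hm h')
      ext z
      rw [Subsingleton.elim z 0, map_zero, map_zero]
  · rw [if_pos hm]
    split_ifs with h'
    · ext z
      exact hψ i hm.1 h'.2 _ _ ((V.compat_left h).2 rfl)
    · ext z
      exact hbwd i (caseHi i hm h') h z

/-- The nonzero quotient of image by indeterminacy is followed to the right. At each arrow either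
some nonzero class dies there, and an interval ending at `d` splits off, or the class of `y` passes
to the next position. -/
theorem Mod.exists_iso_interval_sum_of_image_ne (V : Mod F τ) {b d : Fin n} (hbd : b ≤ d)
    (hb : ∀ i < b, Subsingleton (V.space i)) {y : V.space d} (hy : y ∈ V.image b d)
    (hy' : y ∉ V.indet b d) :
    ∃ (I : Interval n) (U : Mod F τ), V.Iso ((intervalMod F τ I).sum U) := by
  induction hm : n - (d : ℕ) generalizing d with
  | zero => omega
  | succ m ih =>
    by_cases hlast : ∃ i, lo i = d
    · obtain ⟨i, rfl⟩ := hlast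
      have hb' : b ≤ hi i := hbd.trans (lo_lt_hi i).le
      have hm' : n - (hi i : ℕ) = m := by simp only [lo, hi] at *; omega
      cases h : τ i
      · by_cases H : ∃ w ∈ V.image b (lo i), w ∉ V.indet b (lo i) ∧ V.fwd i h w = 0
        · obtain ⟨w, h1, h2, h3⟩ := H
          obtain ⟨φ, h4, h5⟩ := exists_functional_of_notMem _ h2
          refine V.exists_iso_sum_of_mem_image hbd hb h1 h5 h4 fun j e => ?_
          obtain rfl := lo_injective e
          exact ⟨fun _ => h3, fun h' => by simp [h] at h'⟩
        · push Not at H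
          refine ih hb' (y := V.fwd i h y)
            ((Mod.mem_image_hi hbd).2 ⟨y, hy, (V.compat_right h).2 rfl⟩) (fun hf => ?_) hm'
          -- If the image of `y` became indeterminate, `y` would differ from an indeterminate `w` by
          -- an element of the kernel, which by `H` is indeterminate too.
          obtain ⟨w, hw, hwc⟩ := (Mod.mem_indet_hi hbd).1 hf
          rw [V.compat_right h] at hwc
          refine H (y - w) (sub_mem hy (V.indet_le_image _ _ hw)) (fun h' => hy' ?_) ?_
          · simpa using add_mem h' hw
          · rw [map_sub, hwc, sub_self]
      -- For an arrow to the left, a class ends here when it has no lift; the functional must then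
      -- vanish on the range of the arrow as well.
      · by_cases H : ∃ w ∈ V.image b (lo i), w ∉ V.indet b (lo i) ⊔ LinearMap.range (V.bwd i h)
        · obtain ⟨w, h1, h2⟩ := H
          obtain ⟨φ, h4, h5⟩ := exists_functional_of_notMem _ h2
          refine V.exists_iso_sum_of_mem_image hbd hb h1 (le_sup_left.trans h5) h4 fun j e => ?_
          obtain rfl := lo_injective e
          exact ⟨fun h' => by simp [h] at h',
            fun h' z => h5 (le_sup_right (a := V.indet b (lo j)) ⟨z, rfl⟩)⟩
        · push Not at H
          obtain ⟨w, hw, _, ⟨z, rfl⟩, hwz⟩ := Submodule.mem_sup.1 (H y hy)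
          have hz : V.bwd i h z = y - w := by rw [← hwz]; abel
          refine ih hb' (y := z) ((Mod.mem_image_hi hbd).2 ⟨V.bwd i h z, ?_,
            (V.compat_left h).2 rfl⟩) (fun hf => hy' ?_) hm'
          · rw [hz]
            exact sub_mem hy (V.indet_le_image _ _ hw)
          · obtain ⟨w', hw', hwc⟩ := (Mod.mem_indet_hi hbd).1 hf
            rw [V.compat_left h] at hwc
            rw [← hwz, hwc]
            exact add_mem hw hw'
    · obtain ⟨φ, h4, h5⟩ := exists_functional_of_notMem _ hy'
      exact V.exists_iso_sum_of_mem_image hbd hb hy h5 h4 fun j e => absurd ⟨j, e⟩ hlast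

/-! ### Interval decompositions -/

theorem Mod.bigSum_reindex {ι κ : Type} [Fintype ι] [Fintype κ] (e : κ ≃ ι) (X : ι → Mod F τ) :
    (Mod.bigSum X).Iso (Mod.bigSum fun k => X (e k)) :=
  ⟨fun i => LinearEquiv.piCongrLeft' F (fun j => (X j).space i) e.symm,
    fun _ _ _ => rfl, fun _ _ _ => rfl⟩

theorem Mod.bigSum_option {ι : Type} [Fintype ι] (X : Option ι → Mod F τ) :
    (Mod.bigSum X).Iso ((X none).sum (Mod.bigSum fun j => X (some j))) :=
  ⟨fun i => LinearEquiv.piOptionEquivProd F (M := fun j => (X j).space i),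
    fun _ _ _ => rfl, fun _ _ _ => rfl⟩

/-- A finite family enumerates the multiset of its values. -/
theorem exists_equiv_toType {ι α : Type*} [Fintype ι] [DecidableEq α] (f : ι → α) {m : Multiset α}
    (h : Finset.univ.val.map f = m) : ∃ e : ι ≃ m.ToType, ∀ i, (e i).1 = f i := by
  classical
  have key : ∀ a, Nonempty ({i // f i = a} ≃ {x : m.ToType // x.1 = a}) := by
    intro a
    refine Fintype.card_eq.1 ?_
    have h1 := congrArg (Multiset.count a) (h.trans (Multiset.map_univ_coe m).symm)
    rw [Multiset.count_map, Multiset.count_map] at h1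
    rw [Fintype.card_subtype, Fintype.card_subtype, Finset.card_def, Finset.card_def]
    simpa [eq_comm] using h1
  let e := fun a => (key a).some
  exact ⟨Equiv.ofFiberEquiv e, fun i => Equiv.ofFiberEquiv_map e i⟩

theorem intervalSum_cons (I : Interval n) (D : Multiset (Interval n)) :
    (intervalSum F τ (I ::ₘ D)).Iso ((intervalMod F τ I).sum (intervalSum F τ D)) := by
  let f : Option D.ToType → Interval n := fun o => o.elim I Sigma.fst
  obtain ⟨e, he⟩ := exists_equiv_toType f (m := I ::ₘ D) (by
    rw [univ_option]
    simp only [Finset.insertNone, OrderEmbedding.coe_ofMapLEIff, Finset.cons_val,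
      Multiset.map_cons, Finset.map_val, Multiset.map_map]
    exact congrArg (I ::ₘ ·) (Multiset.map_univ_coe D))
  refine (Mod.bigSum_reindex e _).trans ?_
  simp only [he]
  exact Mod.bigSum_option fun o => intervalMod F τ (f o)

theorem Mod.iso_of_subsingleton {V W : Mod F τ} (hV : ∀ i, Subsingleton (V.space i))
    (hW : ∀ i, Subsingleton (W.space i)) : V.Iso W :=
  ⟨fun _ => 0, fun _ _ _ => Subsingleton.elim _ _, fun _ _ _ => Subsingleton.elim _ _⟩

theorem Mod.exists_iso_intervalSum (V : Mod F τ) : ∃ D, V.Iso (intervalSum F τ D) := by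
  induction hm : ∑ i, Module.finrank F (V.space i) using Nat.strong_induction_on
    generalizing V with
  | _ m ih =>
    by_cases H : ∀ i, Subsingleton (V.space i)
    · exact ⟨0, Mod.iso_of_subsingleton H fun i =>
        ⟨fun x y => funext fun j => absurd (Multiset.coe_mem (x := j)) (Multiset.notMem_zero _)⟩⟩
    · push Not at H
      obtain ⟨b, hb, hmin⟩ := WellFounded.has_min (r := ((· < ·) : Fin n → Fin n → Prop))
        wellFounded_lt {i | Nontrivial (V.space i)} H
      have hb' : ∀ i < b, Subsingleton (V.space i) := fun i hi' =>
        not_nontrivial_iff_subsingleton.1 fun h => hmin i h hi'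
      obtain ⟨y, hy⟩ := @exists_ne _ hb 0
      -- From `b` to itself the link is equality, so any nonzero vector at the first nonzero
      -- position may start the search.
      obtain ⟨I, U, hU⟩ := V.exists_iso_interval_sum_of_image_ne le_rfl hb' (y := y)
        (by simp [V.image_self]) (by simpa [V.indet_self] using hy)
      have hdim : ∑ i, Module.finrank F (U.space i) < m := by
        classical
        have h1 : ∀ i, Module.finrank F (V.space i) =
            (intervalMod F τ I).rank i i + Module.finrank F (U.space i) := fun i => by
          rw [← V.rank_self, Mod.rank_eq_of_iso hU, Mod.rank_sum, U.rank_self]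
        rw [← hm]
        refine Finset.sum_lt_sum (fun i _ => by rw [h1]; omega) ⟨I.1.1, Finset.mem_univ _, ?_⟩
        rw [h1, rank_intervalMod I le_rfl, if_pos ⟨I.self_mem_left, I.self_mem_left⟩]
        omega
      obtain ⟨D, hD⟩ := ih _ hdim U rfl
      exact ⟨I ::ₘ D, hU.trans (((Mod.Iso.refl _).sum_congr hD).trans (intervalSum_cons I D).symm)⟩

theorem Mod.iso_dgm (V : Mod F τ) : V.Iso (intervalSum F τ V.dgm) :=
  Classical.epsilon_spec V.exists_iso_intervalSum

theorem Mod.countP_dgm (V : Mod F τ) {b d : Fin n} (hbd : b ≤ d)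
    [DecidablePred fun I : Interval n => I.Mem b ∧ I.Mem d] :
    V.dgm.countP (fun I => I.Mem b ∧ I.Mem d) = V.rank b d := by
  rw [Mod.rank_eq_of_iso V.iso_dgm, rank_intervalSum _ hbd]

/-- The two types may differ, so diagrams can be compared across arrow reversals. -/
theorem Mod.dgm_eq_of_rank_eq {V : Mod F τ} {W : Mod F τ'}
    (h : ∀ b d, b ≤ d → V.rank b d = W.rank b d) : V.dgm = W.dgm := by
  classical
  refine multiset_interval_ext fun b d hbd => ?_
  rw [V.countP_dgm hbd, W.countP_dgm hbd, h b d hbd]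

theorem Mod.iso_of_dgm_eq {V W : Mod F τ} (h : V.dgm = W.dgm) : V.Iso W :=
  V.iso_dgm.trans (h ▸ W.iso_dgm.symm)

theorem dgm_intervalSum (D : Multiset (Interval n)) : (intervalSum F τ D).dgm = D := by
  classical
  refine multiset_interval_ext fun b d hbd => ?_
  rw [Mod.countP_dgm _ hbd, rank_intervalSum _ hbd]

theorem Mod.dgm_sum (V W : Mod F τ) : (V.sum W).dgm = V.dgm + W.dgm := by
  classical
  refine multiset_interval_ext fun b d hbd => ?_
  rw [Mod.countP_dgm _ hbd, Multiset.countP_add, Mod.countP_dgm _ hbd, Mod.countP_dgm _ hbd,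
    Mod.rank_sum]

theorem Mod.Iso.dgm_eq {V W : Mod F τ} (h : V.Iso W) : V.dgm = W.dgm :=
  Mod.dgm_eq_of_rank_eq fun b d _ => Mod.rank_eq_of_iso h b d

theorem Sim.dgm_eq {V : Mod F τ} {W : Mod F τ'} (h : Sim V W) : V.dgm = W.dgm :=
  Mod.dgm_eq_of_rank_eq fun b d _ => h.rank_eq b d

theorem Precsim.dgm_le {W : Mod F τ'} {V : Mod F τ} : Precsim W V → W.dgm ≤ V.dgm := by
  rintro ⟨W', h, U, hU⟩
  rw [h.dgm_eq, hU.dgm_eq, Mod.dgm_sum]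
  exact Multiset.le_add_right _ _

/-! ### Ranks of reflections -/

/-- The new space of `ℒ_k(V)` at `k`. -/
noncomputable def Mod.limAt (V : Mod F τ) (k : Fin n) (e : Dir) {i : Fin n} (h : i = k) :
    (V.reflectLim k e).space i ≃ₗ[F] V.lim k e :=
  replaceAt V.space k (ModuleCat.of F (V.lim k e)) i h

/-- The old spaces of `ℒ_k(V)` away from `k`. -/
noncomputable def Mod.limAway (V : Mod F τ) (k : Fin n) (e : Dir) {i : Fin n} (h : i ≠ k) :
    (V.reflectLim k e).space i ≃ₗ[F] V.space i :=
  replaceAway V.space k (ModuleCat.of F (V.lim k e)) i h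

/-- The new space of `𝒞_k(V)` at `k`. -/
noncomputable def Mod.colimAt (V : Mod F τ) (k : Fin n) (e : Dir) {i : Fin n} (h : i = k) :
    (V.reflectColim k e).space i ≃ₗ[F] V.colim k e :=
  replaceAt V.space k (ModuleCat.of F (V.colim k e)) i h

/-- The old spaces of `𝒞_k(V)` away from `k`. -/
noncomputable def Mod.colimAway (V : Mod F τ) (k : Fin n) (e : Dir) {i : Fin n} (h : i ≠ k) :
    (V.reflectColim k e).space i ≃ₗ[F] V.space i :=
  replaceAway V.space k (ModuleCat.of F (V.colim k e)) i h

theorem Mod.colimAt_congr (V : Mod F τ) {k i j : Fin n} (e : Dir) (hi' : i = k) (hj : j = k)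
    (s : ∀ j, (V.reflectColim k e).space j) : V.colimAt k e hi' (s i) = V.colimAt k e hj (s j) := by
  subst hi'
  subst hj
  rfl

theorem Mod.compat_reflectLim_away (V : Mod F τ) {k : Fin n} {e : Dir} {i : Fin (n - 1)}
    (h1 : lo i ≠ k) (h2 : hi i ≠ k) {x y} :
    (V.reflectLim k e).Compat i x y ↔ V.Compat i (V.limAway k e h1 x) (V.limAway k e h2 y) := by
  have h' : extrovert k τ i = τ i := by simp [extrovert, h1, h2]
  cases h : τ i
  · refine ((V.reflectLim k e).compat_right (h'.trans h)).trans
      (Iff.trans ?_ (V.compat_right h).symm)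
    simp only [Mod.reflectLim, dif_neg h1]
    exact LinearEquiv.symm_apply_eq (V.limAway k e h2)
  · refine ((V.reflectLim k e).compat_left (h'.trans h)).trans
      (Iff.trans ?_ (V.compat_left h).symm)
    simp only [Mod.reflectLim, dif_neg h2]
    exact LinearEquiv.symm_apply_eq (V.limAway k e h1)

theorem Mod.compat_reflectLim_hi (V : Mod F τ) {k : Fin n} {e : Dir} {i : Fin (n - 1)}
    (h1 : lo i ≠ k) (h2 : hi i = k) {x y} :
    (V.reflectLim k e).Compat i x y ↔
      (V.limAt k e h2 y).1 (nbhdLo (.inr h2)) = V.limAway k e h1 x := by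
  have h' : extrovert k τ i = .left := by simp [extrovert, h1, h2]
  refine ((V.reflectLim k e).compat_left h').trans ?_
  simp only [Mod.reflectLim, dif_pos h2]
  exact LinearEquiv.symm_apply_eq (V.limAway k e h1)

theorem Mod.compat_reflectLim_lo (V : Mod F τ) {k : Fin n} {e : Dir} {i : Fin (n - 1)}
    (h1 : lo i = k) (h2 : hi i ≠ k) {x y} :
    (V.reflectLim k e).Compat i x y ↔
      (V.limAt k e h1 x).1 (nbhdHi (.inl h1)) = V.limAway k e h2 y := by
  have h' : extrovert k τ i = .right := by simp [extrovert, h1]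
  refine ((V.reflectLim k e).compat_right h').trans ?_
  simp only [Mod.reflectLim, dif_pos h1]
  exact LinearEquiv.symm_apply_eq (V.limAway k e h2)

theorem Mod.compat_reflectColim_away (V : Mod F τ) {k : Fin n} {e : Dir} {i : Fin (n - 1)}
    (h1 : lo i ≠ k) (h2 : hi i ≠ k) {x y} :
    (V.reflectColim k e).Compat i x y ↔
      V.Compat i (V.colimAway k e h1 x) (V.colimAway k e h2 y) := by
  have h' : introvert k τ i = τ i := by simp [introvert, h1, h2]
  cases h : τ i
  · refine ((V.reflectColim k e).compat_right (h'.trans h)).trans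
      (Iff.trans ?_ (V.compat_right h).symm)
    simp only [Mod.reflectColim, dif_neg h2]
    exact LinearEquiv.symm_apply_eq (V.colimAway k e h2)
  · refine ((V.reflectColim k e).compat_left (h'.trans h)).trans
      (Iff.trans ?_ (V.compat_left h).symm)
    simp only [Mod.reflectColim, dif_neg h1]
    exact LinearEquiv.symm_apply_eq (V.colimAway k e h1)

theorem Mod.compat_reflectColim_hi (V : Mod F τ) {k : Fin n} {e : Dir} {i : Fin (n - 1)}
    (h1 : lo i ≠ k) (h2 : hi i = k) {x y} :
    (V.reflectColim k e).Compat i x y ↔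
      V.colimInj k e (nbhdLo (.inr h2)) (V.colimAway k e h1 x) = V.colimAt k e h2 y := by
  have h' : introvert k τ i = .right := by simp [introvert, h1, h2]
  refine ((V.reflectColim k e).compat_right h').trans ?_
  simp only [Mod.reflectColim, dif_pos h2]
  exact LinearEquiv.symm_apply_eq (V.colimAt k e h2)

theorem Mod.compat_reflectColim_lo (V : Mod F τ) {k : Fin n} {e : Dir} {i : Fin (n - 1)}
    (h1 : lo i = k) (h2 : hi i ≠ k) {x y} :
    (V.reflectColim k e).Compat i x y ↔
      V.colimInj k e (nbhdHi (.inl h1)) (V.colimAway k e h2 y) = V.colimAt k e h1 x := by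
  have h' : introvert k τ i = .left := by simp [introvert, h1]
  refine ((V.reflectColim k e).compat_left h').trans ?_
  simp only [Mod.reflectColim, dif_pos h1]
  exact LinearEquiv.symm_apply_eq (V.colimAt k e h1)

theorem Mod.compat_of_mem_lim {V : Mod F τ} {k : Fin n} {e : Dir} {x : ∀ j : Nbhd k, V.space j}
    (hx : x ∈ V.lim k e) (i : Fin (n - 1)) (t : lo i = k ∨ hi i = k) :
    V.Compat i (x (nbhdLo t)) (x (nbhdHi t)) :=
  ⟨hx.1 i t, hx.2.1 i t⟩

/-- A vector of the limit is a compatible family around `k`. Its central component fills position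
`k` in one direction, and in the other a family of `V` restricts to such a vector. -/
theorem Mod.link_reflectLim (V : Mod F τ) {k b d : Fin n} (e : Dir) (hb : b ≠ k) (hd : d ≠ k)
    (x : (V.reflectLim k e).space b) (z : (V.reflectLim k e).space d) :
    (x, z) ∈ (V.reflectLim k e).link b d ↔
      (V.limAway k e hb x, V.limAway k e hd z) ∈ V.link b d := by
  rw [Mod.mem_link, Mod.mem_link]
  constructor
  · rintro ⟨s, hs, rfl, rfl⟩
    obtain ⟨t, ht, htk⟩ : ∃ t : ∀ j, V.space j, (∀ j (h : j ≠ k), t j = V.limAway k e h (s j)) ∧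
        t k = (V.limAt k e rfl (s k)).1 (nbhdCenter k) := by
      obtain ⟨c, hc⟩ : ∃ c : V.space k, c = (V.limAt k e rfl (s k)).1 (nbhdCenter k) := ⟨_, rfl⟩
      exact ⟨Function.update (fun j => if h : j = k then 0 else V.limAway k e h (s j)) k c,
        fun j h => by simp [h], by rw [Function.update_self]; exact hc⟩
    refine ⟨t, fun i h1 h2 => ?_, ht b hb, ht d hd⟩
    have hc := hs i h1 h2
    by_cases hl : lo i = k
    · have hh : hi i ≠ k := fun h => lo_ne_hi i (hl.trans h.symm)
      rw [V.compat_reflectLim_lo hl hh, ← ht] at hc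
      subst hl
      rw [← hc, htk]
      exact V.compat_of_mem_lim (V.limAt (lo i) e rfl (s (lo i))).2 i (.inl rfl)
    · by_cases hh : hi i = k
      · rw [V.compat_reflectLim_hi hl hh, ← ht] at hc
        subst hh
        rw [← hc, htk]
        exact V.compat_of_mem_lim (V.limAt (hi i) e rfl (s (hi i))).2 i (.inr rfl)
      · rwa [V.compat_reflectLim_away hl hh, ← ht, ← ht] at hc
  · rintro ⟨s, hs, hsb, hsd⟩
    -- Arrows at `k` matter only if `k` lies strictly between `b` and `d`; then `k` is no end
    -- position and the condition on `e` is void. Otherwise `0` serves.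
    obtain ⟨l, hl⟩ : ∃ l : V.lim k e, b < k → k < d → ∀ j, l.1 j = s j := by
      by_cases hk : b < k ∧ k < d
      · have hc : ∀ i, lo i = k ∨ hi i = k → V.Compat i (s (lo i)) (s (hi i)) := by
          rintro i (rfl | rfl)
          · exact hs i hk.1.le (hi_le_of_lo_lt hk.2)
          · exact hs i (le_lo_of_lt_hi hk.1) hk.2.le
        refine ⟨⟨fun j => s j, fun i t => (hc i t).1, fun i t => (hc i t).2, fun h => ?_,
          fun h => ?_⟩, fun _ _ _ => rfl⟩
        · exact absurd hk.1 (by simp [Fin.lt_def, h])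
        · exact absurd hk.2 (by simp only [Fin.lt_def]; omega)
      · exact ⟨0, fun h1 h2 => absurd ⟨h1, h2⟩ hk⟩
    let t : ∀ j, (V.reflectLim k e).space j := fun j =>
      if h : j = k then (V.limAt k e h).symm l else (V.limAway k e h).symm (s j)
    have ht : ∀ j (h : j ≠ k), t j = (V.limAway k e h).symm (s j) := fun j h => by simp [t, h]
    have htk : ∀ j (h : j = k), t j = (V.limAt k e h).symm l := fun j h => by simp [t, h]
    refine ⟨t, fun i h1 h2 => ?_, ?_, ?_⟩
    · by_cases hl' : lo i = k
      · have hh : hi i ≠ k := fun h => lo_ne_hi i (hl'.trans h.symm)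
        rw [V.compat_reflectLim_lo hl' hh, ht _ hh, htk _ hl', LinearEquiv.apply_symm_apply,
          LinearEquiv.apply_symm_apply]
        exact hl (lt_of_le_of_ne (h1.trans hl'.le) hb) (hl' ▸ (lo_lt_hi i).trans_le h2) _
      · by_cases hh : hi i = k
        · rw [V.compat_reflectLim_hi hl' hh, ht _ hl', htk _ hh, LinearEquiv.apply_symm_apply,
            LinearEquiv.apply_symm_apply]
          exact hl (hh ▸ h1.trans_lt (lo_lt_hi i)) (lt_of_le_of_ne (hh.symm.le.trans h2) hd.symm) _
        · rw [V.compat_reflectLim_away hl' hh, ht _ hl', ht _ hh, LinearEquiv.apply_symm_apply,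
            LinearEquiv.apply_symm_apply]
          exact hs i h1 h2
    · rw [ht _ hb, LinearEquiv.symm_apply_eq, hsb]
    · rw [ht _ hd, LinearEquiv.symm_apply_eq, hsd]

theorem Mod.nbhdSingle_apply (V : Mod F τ) {k : Fin n} (j₀ : Nbhd k) (u : ∀ j, V.space j)
    (j : Nbhd k) : V.nbhdSingle k j₀ (u j₀) j = if j = j₀ then u j else 0 := by
  split_ifs with h
  · subst h
    simp [Mod.nbhdSingle]
  · simp [Mod.nbhdSingle, h]

theorem Mod.colimInj_eq_of_compat (V : Mod F τ) {k : Fin n} (e : Dir) {i : Fin (n - 1)}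
    (t : lo i = k ∨ hi i = k) {x y} (h : V.Compat i x y) :
    V.colimInj k e (nbhdLo t) x = V.colimInj k e (nbhdHi t) y := by
  refine (Submodule.Quotient.eq (V.colimRel k e)).2 ?_
  cases hd : τ i
  · refine Submodule.subset_span (Or.inl (Or.inl ⟨i, t, hd, x, ?_⟩))
    rw [h.1]
  · rw [← neg_sub]
    refine neg_mem (Submodule.subset_span (Or.inl (Or.inr ⟨i, t, hd, y, ?_⟩)))
    rw [h.2]

/-- Vectors at `k - 1` and `k + 1` that agree in the colimit are already linked through `V_k`. This
is the nontrivial half of the invariance of links under colimits. -/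
theorem Mod.exists_compat_of_colimInj_eq (V : Mod F τ) {k : Fin n} {e : Dir} {i₁ i₂ : Fin (n - 1)}
    (h1 : hi i₁ = k) (h2 : lo i₂ = k) (t : ∀ j, V.space j)
    (h : V.colimInj k e (nbhdLo (.inr h1)) (t (lo i₁)) =
      V.colimInj k e (nbhdHi (.inl h2)) (t (hi i₂))) :
    ∃ s : ∀ j, V.space j, (∀ j ≠ k, s j = t j) ∧ V.Compat i₁ (s (lo i₁)) (s (hi i₁)) ∧
      V.Compat i₂ (s (lo i₂)) (s (hi i₂)) := by
  have hk1 : lo i₁ < k := h1 ▸ lo_lt_hi i₁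
  have hk2 : k < hi i₂ := h2 ▸ lo_lt_hi i₂
  -- Triples `(p_{k-1}, q_k - p_k, -q_{k+1})` with `p` compatible along `i₁` and `q` along `i₂`.
  -- They contain all defining relations; a triple with middle entry zero has `p_k = q_k`, the
  -- vector sought.
  let Q : Submodule F (∀ j : Nbhd k, V.space j) :=
    { carrier := {w | ∃ p q : ∀ j, V.space j, V.Compat i₁ (p (lo i₁)) (p (hi i₁)) ∧
        V.Compat i₂ (q (lo i₂)) (q (hi i₂)) ∧ w (nbhdLo (.inr h1)) = p (lo i₁) ∧
        w (nbhdCenter k) = q k - p k ∧ w (nbhdHi (.inl h2)) = - q (hi i₂)}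
      zero_mem' := ⟨0, 0, V.compat_zero _, V.compat_zero _, rfl, (sub_zero _).symm, neg_zero.symm⟩
      add_mem' := by
        rintro w w' ⟨p, q, a1, a2, a3, a4, a5⟩ ⟨p', q', b1, b2, b3, b4, b5⟩
        refine ⟨p + p', q + q', a1.add b1, a2.add b2, congrArg₂ (· + ·) a3 b3, ?_, ?_⟩
        · rw [Pi.add_apply, a4, b4, Pi.add_apply, Pi.add_apply]
          abel
        · rw [Pi.add_apply, a5, b5, Pi.add_apply]
          exact (neg_add _ _).symm
      smul_mem' := by
        rintro c w ⟨p, q, a1, a2, a3, a4, a5⟩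
        refine ⟨c • p, c • q, a1.smul c, a2.smul c, congrArg (c • ·) a3, ?_, ?_⟩
        · rw [Pi.smul_apply, a4, Pi.smul_apply, Pi.smul_apply]
          exact smul_sub _ _ _
        · rw [Pi.smul_apply, a5, Pi.smul_apply]
          exact smul_neg _ _ }
  have hgen : ∀ (i : Fin (n - 1)) (t : lo i = k ∨ hi i = k) (x : V.space (lo i))
      (y : V.space (hi i)), V.Compat i x y →
      V.nbhdSingle k (nbhdLo t) x - V.nbhdSingle k (nbhdHi t) y ∈ Q := by
    intro i t x y hxy
    obtain ⟨u, rfl, rfl⟩ : ∃ u : ∀ j, V.space j, u (lo i) = x ∧ u (hi i) = y :=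
      ⟨Function.update (Function.update 0 (lo i) x) (hi i) y,
        by simp [Function.update_of_ne (lo_ne_hi i)], by simp⟩
    have hval : ∀ j : Nbhd k, (V.nbhdSingle k (nbhdLo t) (u (lo i)) -
        V.nbhdSingle k (nbhdHi t) (u (hi i))) j =
        (if j = nbhdLo t then u j else 0) - if j = nbhdHi t then u j else 0 := fun j => by
      rw [← V.nbhdSingle_apply, ← V.nbhdSingle_apply]
      rfl
    by_cases ht : lo i = k
    · obtain rfl : i = i₂ := lo_injective (ht.trans h2.symm)
      refine ⟨0, u, V.compat_zero _, hxy, ?_, ?_, ?_⟩ <;> rw [hval] <;>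
        simp [nbhdLo, nbhdHi, nbhdCenter, Subtype.ext_iff, h2, hk1.ne, hk2.ne, hk2.ne',
          (hk1.trans hk2).ne]
      exacts [sub_zero _, sub_zero _, zero_sub _]
    · have ht' := t.resolve_left ht
      obtain rfl : i = i₁ := hi_injective (ht'.trans h1.symm)
      refine ⟨u, 0, hxy, V.compat_zero _, ?_, ?_, ?_⟩ <;> rw [hval] <;>
        simp [nbhdLo, nbhdHi, nbhdCenter, Subtype.ext_iff, h1, hk1.ne, hk1.ne', hk2.ne',
          (hk1.trans hk2).ne']
      exacts [sub_zero _, zero_sub _, sub_zero _]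
  have hle : V.colimRel k e ≤ Q := by
    refine Submodule.span_le.2 ?_
    rintro z ((⟨i, t, hd, x, rfl⟩ | ⟨i, t, hd, x, rfl⟩) | ⟨hk, -⟩)
    · exact hgen i t _ _ ((V.compat_right hd).2 rfl)
    · have := neg_mem (hgen i t _ x ((V.compat_left hd).2 rfl))
      rwa [neg_sub] at this
    · exfalso
      simp only [Fin.lt_def] at hk1 hk2
      omega
  obtain ⟨p, q, a1, a2, a3, a4, a5⟩ := hle ((Submodule.Quotient.eq (V.colimRel k e)).1 h)
  have hval : ∀ j : Nbhd k, (V.nbhdSingle k (nbhdLo (.inr h1)) (t (lo i₁)) -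
      V.nbhdSingle k (nbhdHi (.inl h2)) (t (hi i₂))) j =
      (if j = nbhdLo (.inr h1) then t j else 0) - if j = nbhdHi (.inl h2) then t j else 0 :=
    fun j => by
      rw [← V.nbhdSingle_apply, ← V.nbhdSingle_apply]
      rfl
  have c1 : t (lo i₁) = p (lo i₁) := by
    refine Eq.trans ?_ a3
    rw [hval]
    rw [if_pos rfl, if_neg (fun h => (hk1.trans hk2).ne (congrArg Subtype.val h))]
    exact (sub_zero _).symm
  have c2 : p k = q k := by
    have := (hval (nbhdCenter k)).symm.trans a4
    rw [if_neg (fun h => hk1.ne' (congrArg Subtype.val h)),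
      if_neg (fun h => hk2.ne (congrArg Subtype.val h))] at this
    exact (sub_eq_zero.1 (this.symm.trans (sub_zero _))).symm
  have c3 : t (hi i₂) = q (hi i₂) := by
    have := (hval (nbhdHi (.inl h2))).symm.trans a5
    rw [if_neg (fun h => (hk1.trans hk2).ne' (congrArg Subtype.val h)), if_pos rfl] at this
    exact neg_injective ((zero_sub _).symm.trans this)
  have hp : ∀ j, j = k → Function.update t k (p k) j = p j := by
    rintro _ rfl
    simp
  have hq : ∀ j, j = k → Function.update t k (p k) j = q j := by
    rintro _ rfl
    simp [c2]
  refine ⟨Function.update t k (p k), fun j hj => Function.update_of_ne hj _ _, ?_, ?_⟩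
  · rw [hp _ h1, Function.update_of_ne hk1.ne, c1]
    exact a1
  · rw [hq _ h2, Function.update_of_ne hk2.ne', c3]
    exact a2

theorem Mod.link_reflectColim (V : Mod F τ) {k b d : Fin n} (e : Dir) (hb : b ≠ k) (hd : d ≠ k)
    (x : (V.reflectColim k e).space b) (z : (V.reflectColim k e).space d) :
    (x, z) ∈ (V.reflectColim k e).link b d ↔
      (V.colimAway k e hb x, V.colimAway k e hd z) ∈ V.link b d := by
  rw [Mod.mem_link, Mod.mem_link]
  constructor
  · rintro ⟨s, hs, rfl, rfl⟩
    let t : ∀ j, V.space j := fun j => if h : j = k then 0 else V.colimAway k e h (s j)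
    have ht : ∀ j (h : j ≠ k), t j = V.colimAway k e h (s j) := fun j h => by simp [t, h]
    -- The family on the colimit side does not supply a vector of `V_k`. One is needed only for `b <
    -- k < d`, where it comes from the two equal injections.
    obtain ⟨r, hr, hr'⟩ : ∃ r : ∀ j, V.space j, (∀ j ≠ k, r j = t j) ∧
        ∀ i, b ≤ lo i → hi i ≤ d → (lo i = k ∨ hi i = k) → V.Compat i (r (lo i)) (r (hi i)) := by
      by_cases hk : b < k ∧ k < d
      · obtain ⟨i₁, h1⟩ := exists_hi_eq hk.1
        obtain ⟨i₂, h2⟩ := exists_lo_eq hk.2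
        have hl : lo i₁ ≠ k := fun h => lo_ne_hi i₁ (h.trans h1.symm)
        have hh : hi i₂ ≠ k := fun h => lo_ne_hi i₂ (h2.trans h.symm)
        have g1 := (V.compat_reflectColim_hi hl h1).1
          (hs i₁ (le_lo_of_lt_hi (h1 ▸ hk.1)) (h1 ▸ hk.2.le))
        have g2 := (V.compat_reflectColim_lo h2 hh).1
          (hs i₂ (h2 ▸ hk.1.le) (hi_le_of_lo_lt (h2 ▸ hk.2)))
        have g3 := V.colimAt_congr e h1 h2 s
        obtain ⟨r, hr, a1, a2⟩ := V.exists_compat_of_colimInj_eq (e := e) h1 h2 t (by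
          rw [ht _ hl, ht _ hh]
          exact g1.trans (g3.trans g2.symm))
        refine ⟨r, hr, fun i _ _ h => ?_⟩
        rcases h with h | h
        · obtain rfl := lo_injective (h.trans h2.symm)
          exact a2
        · obtain rfl := hi_injective (h.trans h1.symm)
          exact a1
      · refine ⟨t, fun _ _ => rfl, fun i h1 h2 h => absurd ?_ hk⟩
        rcases h with h | h
        · exact ⟨lt_of_le_of_ne (h1.trans h.le) hb, h ▸ (lo_lt_hi i).trans_le h2⟩
        · exact ⟨h ▸ h1.trans_lt (lo_lt_hi i), lt_of_le_of_ne (h.symm.le.trans h2) hd.symm⟩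
    refine ⟨r, fun i h1 h2 => ?_, (hr b hb).trans (ht b hb), (hr d hd).trans (ht d hd)⟩
    by_cases h : lo i = k ∨ hi i = k
    · exact hr' i h1 h2 h
    · rw [not_or] at h
      rw [hr _ h.1, hr _ h.2, ht _ h.1, ht _ h.2, ← V.compat_reflectColim_away]
      exact hs i h1 h2
  · rintro ⟨s, hs, hsb, hsd⟩
    let l : V.colim k e := V.colimInj k e (nbhdCenter k) (s k)
    let t : ∀ j, (V.reflectColim k e).space j := fun j =>
      if h : j = k then (V.colimAt k e h).symm l else (V.colimAway k e h).symm (s j)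
    have ht : ∀ j (h : j ≠ k), t j = (V.colimAway k e h).symm (s j) := fun j h => by simp [t, h]
    have htk : ∀ j (h : j = k), t j = (V.colimAt k e h).symm l := fun j h => by simp [t, h]
    refine ⟨t, fun i h1 h2 => ?_, ?_, ?_⟩
    · have hc := hs i h1 h2
      by_cases hl' : lo i = k
      · have hh : hi i ≠ k := fun h => lo_ne_hi i (hl'.trans h.symm)
        rw [V.compat_reflectColim_lo hl' hh, ht _ hh, htk _ hl', LinearEquiv.apply_symm_apply,
          LinearEquiv.apply_symm_apply, ← V.colimInj_eq_of_compat e (.inl hl') hc]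
        subst hl'
        rfl
      · by_cases hh : hi i = k
        · rw [V.compat_reflectColim_hi hl' hh, ht _ hl', htk _ hh, LinearEquiv.apply_symm_apply,
            LinearEquiv.apply_symm_apply, V.colimInj_eq_of_compat e (.inr hh) hc]
          subst hh
          rfl
        · rwa [V.compat_reflectColim_away hl' hh, ht _ hl', ht _ hh, LinearEquiv.apply_symm_apply,
            LinearEquiv.apply_symm_apply]
    · rw [ht _ hb, LinearEquiv.symm_apply_eq, hsb]
    · rw [ht _ hd, LinearEquiv.symm_apply_eq, hsd]

/-- The position of a reflection. -/
def Reflection.index : Reflection n → Fin n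
  | .lim k _ => k
  | .colim k _ => k

theorem Reflection.rank_onMod (r : Reflection n) (V : Mod F τ) {b d : Fin n} (hb : b ≠ r.index)
    (hd : d ≠ r.index) : (r.onMod V).rank b d = V.rank b d := by
  cases r with
  | lim k e =>
    exact Mod.rank_eq_of_equiv (V.limAway k e hb) (V.limAway k e hd)
      (V.link_reflectLim e hb hd)
  | colim k e =>
    exact Mod.rank_eq_of_equiv (V.colimAway k e hb) (V.colimAway k e hd)
      (V.link_reflectColim e hb hd)

/-! ### The effect of reflections on persistence diagrams -/

/-- The multiset of intervals with more than one element. -/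
def nonsimple (D : Multiset (Interval n)) : Multiset (Interval n) := D.filter fun I => I.1.1 ≠ I.1.2

theorem Mod.dgm_removeSimple (V : Mod F τ) : V.removeSimple.dgm = nonsimple V.dgm :=
  dgm_intervalSum _

/-- The end points of `I` and `J` differ by at most `l`. -/
def Interval.Close (l : ℕ) (I J : Interval n) : Prop :=
  ((I.1.1 : ℕ) ≤ J.1.1 + l ∧ (J.1.1 : ℕ) ≤ I.1.1 + l) ∧
    ((I.1.2 : ℕ) ≤ J.1.2 + l ∧ (J.1.2 : ℕ) ≤ I.1.2 + l)

theorem Interval.close_refl (l : ℕ) (I : Interval n) : I.Close l I :=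
  ⟨⟨by omega, by omega⟩, by omega, by omega⟩

theorem Interval.Close.trans {l m : ℕ} {I J K : Interval n} (h : I.Close l J) (h' : J.Close m K) :
    I.Close (m + l) K := by
  obtain ⟨⟨h1, h2⟩, h3, h4⟩ := h
  obtain ⟨⟨g1, g2⟩, g3, g4⟩ := h'
  exact ⟨⟨by omega, by omega⟩, by omega, by omega⟩

/-- Only the position `k` of `I` may lie outside `J`. Were an end of `I` two or more beyond `J`,
that end or its inner neighbour would be a second such position; the common point `c` keeps the
neighbour inside `I`. -/
theorem Interval.ends_le_of_mem_imp {I J : Interval n} {k c : Fin n} (hI : I.Mem c) (hJ : J.Mem c)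
    (h : ∀ i, i ≠ k → I.Mem i → J.Mem i) :
    (J.1.1 : ℕ) ≤ I.1.1 + 1 ∧ (I.1.2 : ℕ) ≤ J.1.2 + 1 := by
  obtain ⟨⟨⟨b, hb⟩, ⟨d, hd⟩⟩, hbd⟩ := I
  obtain ⟨⟨⟨b', hb'⟩, ⟨d', hd'⟩⟩, hbd'⟩ := J
  obtain ⟨k, hk⟩ := k
  obtain ⟨c, hc⟩ := c
  simp only [Interval.Mem, Fin.le_def, ne_eq, Fin.ext_iff] at *
  have H : ∀ i, i < n → i ≠ k → b ≤ i → i ≤ d → b' ≤ i ∧ i ≤ d' := fun i hi' hik h1 h2 =>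
    h ⟨i, hi'⟩ hik ⟨h1, h2⟩
  constructor
  · by_contra hlt
    by_cases hbk : b = k
    · have := H (b + 1) (by omega) (by omega) (by omega) (by omega)
      omega
    · have := H b (by omega) hbk (by omega) (by omega)
      omega
  · by_contra hlt
    by_cases hbk : d = k
    · have := H (d - 1) (by omega) (by omega) (by omega) (by omega)
      omega
    · have := H d (by omega) hbk (by omega) (by omega)
      omega

theorem Interval.close_of_trace_eq {I J : Interval n} {k : Fin n}
    (h : I.trace (· ≠ k) = J.trace (· ≠ k)) (hne : (J.trace (· ≠ k)).Nonempty) : I.Close 1 J := by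
  have H : ∀ i, i ≠ k → (I.Mem i ↔ J.Mem i) := fun i hik => by
    simpa [Interval.mem_trace, hik] using Finset.ext_iff.1 h i
  obtain ⟨c, hc⟩ := hne
  obtain ⟨hJ, hck⟩ := Interval.mem_trace.1 hc
  have hI := (H c hck).2 hJ
  have h1 := Interval.ends_le_of_mem_imp hI hJ fun i hi' => (H i hi').1
  have h2 := Interval.ends_le_of_mem_imp hJ hI fun i hi' => (H i hi').2
  exact ⟨⟨h2.1, h1.1⟩, h1.2, h2.2⟩

theorem Interval.trace_nonempty {I : Interval n} (h : I.1.1 ≠ I.1.2) (k : Fin n) :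
    (I.trace (· ≠ k)).Nonempty := by
  by_cases hk : I.1.1 = k
  · exact ⟨I.1.2, Interval.mem_trace.2 ⟨I.self_mem_right, fun h' => h (hk.trans h'.symm)⟩⟩
  · exact ⟨I.1.1, Interval.mem_trace.2 ⟨I.self_mem_left, hk⟩⟩

/-- Ranks away from the reflected position `k` are kept, so the nonempty traces off `k` agree as
multisets, which pairs the intervals. `E` omits only intervals with empty trace, namely copies of
`[k,k]`, which the next `𝒮` discards anyway. -/
theorem Reflection.dgm_onMod (r : Reflection n) (V : Mod F τ) (hV : nonsimple V.dgm = V.dgm) :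
    ∃ E : Multiset (Interval n), Multiset.Rel (Interval.Close 1) V.dgm E ∧
      nonsimple E = nonsimple (r.onMod V).dgm := by
  classical
  let t := Interval.trace (n := n) (· ≠ r.index)
  have hns : ∀ I ∈ V.dgm, I.1.1 ≠ I.1.2 := fun I hI => by
    rw [← hV] at hI
    exact (Multiset.mem_filter.1 hI).2
  refine ⟨(r.onMod V).dgm.filter fun I => (t I).Nonempty, ?_, ?_⟩
  · have key : V.dgm.map t = ((r.onMod V).dgm.filter fun I => (t I).Nonempty).map t := by
      ext T
      rcases T.eq_empty_or_nonempty with rfl | hT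
      · rw [Multiset.count_eq_zero_of_notMem, Multiset.count_eq_zero_of_notMem]
        · simp only [Multiset.mem_map, Multiset.mem_filter]
          rintro ⟨I, ⟨_, hI⟩, h⟩
          simp [h] at hI
        · simp only [Multiset.mem_map]
          rintro ⟨I, hI, h⟩
          have := Interval.trace_nonempty (hns I hI) r.index
          change t I = ∅ at h
          change (t I).Nonempty at this
          simp [h] at this
      · have h1 := count_trace_eq (· ≠ r.index) (D := V.dgm) (E := (r.onMod V).dgm)
          (fun b d hbd hb hd => by
            rw [Mod.countP_dgm _ hbd, Mod.countP_dgm _ hbd, r.rank_onMod V hb hd]) hT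
        refine h1.trans ?_
        rw [Multiset.count_map, Multiset.count_map, Multiset.filter_filter]
        congr 1
        refine Multiset.filter_congr fun I _ => ⟨fun h => ⟨h, ?_⟩, fun h => h.1⟩
        exact (show t I = T from h.symm) ▸ hT
    refine (Multiset.rel_map.1 (Multiset.rel_eq.2 key)).mono fun I _ J hJ h => ?_
    exact Interval.close_of_trace_eq h (Multiset.mem_filter.1 hJ).2
  · rw [nonsimple, nonsimple, Multiset.filter_filter]
    exact Multiset.filter_congr fun I _ =>
      ⟨fun h => h.1, fun h => ⟨h, Interval.trace_nonempty h _⟩⟩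

theorem rel_comp {α β γ : Type*} {r : α → β → Prop} {s : β → γ → Prop} {A : Multiset α}
    {B : Multiset β} {C : Multiset γ} (h : Multiset.Rel r A B) (h' : Multiset.Rel s B C) :
    Multiset.Rel (fun a c => ∃ b, r a b ∧ s b c) A C := by
  induction h generalizing C with
  | zero =>
    rw [Multiset.rel_zero_left] at h'
    exact h' ▸ Multiset.Rel.zero
  | cons hab _ ih =>
    obtain ⟨c, C', hc, hC', rfl⟩ := Multiset.rel_cons_left.1 h'
    exact Multiset.Rel.cons ⟨_, hab, hc⟩ (ih hC')

/-- `A` holds the intervals that survive and `U` those that become simple on the way. Undoing one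
reflection moves each end by at most one, so it lengthens a lost interval by at most two. -/
theorem dgm_seqMod (R : List (Reflection n)) {τ : ZType n} (V : Mod F τ) :
    ∃ A U : Multiset (Interval n), nonsimple V.dgm = A + U ∧
      Multiset.Rel (Interval.Close R.length) A (seqMod R V).dgm ∧
      ∀ I ∈ U, (I.1.2 : ℕ) ≤ I.1.1 + 2 * R.length := by
  induction R generalizing τ with
  | nil =>
    refine ⟨nonsimple V.dgm, 0, (add_zero _).symm, ?_, fun I hI => by simp at hI⟩
    change Multiset.Rel _ _ (V.removeSimple).dgm
    rw [V.dgm_removeSimple]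
    exact Multiset.rel_refl_of_refl_on fun I _ => I.close_refl _
  | cons r R ih =>
    obtain ⟨E, hE, hE'⟩ := r.dgm_onMod V.removeSimple (by
      rw [V.dgm_removeSimple, nonsimple, nonsimple, Multiset.filter_filter]
      simp)
    rw [V.dgm_removeSimple] at hE
    obtain ⟨A, U, h1, h2, h3⟩ := ih (r.onMod V.removeSimple)
    -- After the first reflection an interval survives to the end, is lost later, or is simple at
    -- once.
    have h4 : E = A + (U + E.filter fun I => ¬ I.1.1 ≠ I.1.2) := by
      rw [← add_assoc, ← h1, ← hE']
      exact (Multiset.filter_add_not _ _).symm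
    rw [h4] at hE
    obtain ⟨A', U', hA, hU, h5⟩ := Multiset.rel_add_right.1 hE
    refine ⟨A', U', h5, (rel_comp hA h2).mono ?_, fun I hI => ?_⟩
    · rintro I _ J _ ⟨K, hIK, hKJ⟩
      exact hIK.trans hKJ
    · obtain ⟨J, hJ, hIJ⟩ := Multiset.exists_mem_of_rel_of_mem hU hI
      obtain ⟨⟨g1, g2⟩, g3, g4⟩ := hIJ
      rw [List.length_cons]
      rcases Multiset.mem_add.1 hJ with hJ | hJ
      · have := h3 J hJ
        omega
      · have := not_not.1 (Multiset.mem_filter.1 hJ).2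
        rw [Fin.ext_iff] at this
        omega

/-! ### Matchings -/

/-- The opposite matching. -/
def Matching.swap {S T : Type*} (M : Matching S T) : Matching T S where
  rel t s := M.rel s t
  right_unique t s s' := M.left_unique s s' t
  left_unique t t' s := M.right_unique s t t'

/-- The elements reached by alternating paths that start at an element unmatched in `N`. -/
inductive Matching.Reach {S T : Type*} (M N : Matching S T) : S → Prop
  | base {s} (h : ∀ t, ¬ N.rel s t) : Reach M N s
  | step {s s' t} (h : Reach M N s) (h1 : M.rel s t) (h2 : N.rel s' t) : Reach M N s'

/-- The Mendelsohn-Dulmage theorem: two matchings contain a third one that covers all that the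
first one covers on one side and all that the second one covers on the other side. -/
theorem Matching.exists_union {S T : Type*} (M N : Matching S T) :
    ∃ H : Matching S T, (∀ s t, H.rel s t → M.rel s t ∨ N.rel s t) ∧
      (∀ s, (∀ t, ¬ H.rel s t) → ∀ t, ¬ M.rel s t) ∧
      ∀ t, (∀ s, ¬ H.rel s t) → ∀ s, ¬ N.rel s t := by
  -- Use `M` on the reached elements and `N` on the rest. No `t` is claimed twice: if `M` takes `t`
  -- from a reached element, the `N`-partner of `t` is reached as well.
  refine ⟨⟨fun s t => (M.Reach N s ∧ M.rel s t) ∨ (¬ M.Reach N s ∧ N.rel s t), ?_, ?_⟩, ?_, ?_, ?_⟩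
  · rintro s t t' (⟨h1, h2⟩ | ⟨h1, h2⟩) (⟨g1, g2⟩ | ⟨g1, g2⟩)
    · exact M.right_unique s t t' h2 g2
    · exact absurd h1 g1
    · exact absurd g1 h1
    · exact N.right_unique s t t' h2 g2
  · rintro s s' t (⟨h1, h2⟩ | ⟨h1, h2⟩) (⟨g1, g2⟩ | ⟨g1, g2⟩)
    · exact M.left_unique s s' t h2 g2
    · exact absurd (Reach.step h1 h2 g2) g1
    · exact absurd (Reach.step g1 g2 h2) h1
    · exact N.left_unique s s' t h2 g2
  · rintro s t (h | h)
    · exact Or.inl h.2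
    · exact Or.inr h.2
  · intro s hs t ht
    by_cases h : M.Reach N s
    · exact hs t (Or.inl ⟨h, ht⟩)
    · refine h (Reach.base fun t' ht' => hs t' (Or.inr ⟨h, ht'⟩))
  · intro t ht s hs
    by_cases h : M.Reach N s
    · cases h with
      | base h => exact h t hs
      | step h h1 h2 =>
        obtain rfl := N.right_unique _ _ _ hs h2
        exact ht _ (Or.inl ⟨h, h1⟩)
    · exact ht s (Or.inr ⟨h, hs⟩)

theorem exists_pairs_of_rel {α : Type*} {r : α → α → Prop} {A B : Multiset α}
    (h : Multiset.Rel r A B) : ∃ P : Multiset (α × α), P.map Prod.fst = A ∧ P.map Prod.snd = B ∧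
      ∀ p ∈ P, r p.1 p.2 := by
  induction h with
  | zero => exact ⟨0, rfl, rfl, by simp⟩
  | @cons a b _ _ hab _ ih =>
    obtain ⟨P, rfl, rfl, hP⟩ := ih
    refine ⟨(a, b) ::ₘ P, by simp, by simp, fun p hp => ?_⟩
    rcases Multiset.mem_cons.1 hp with rfl | hp
    · exact hab
    · exact hP p hp

/-- `S` and `T` are enumerated by a common multiset of related pairs together with `U` and `U'`, and
the two copies of each pair are matched. -/
theorem exists_matching_of_rel {α : Type*} [DecidableEq α] {r : α → α → Prop}
    {A B U U' S T : Multiset α} (h : Multiset.Rel r A B) (hS : S = A + U) (hT : T = B + U') :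
    ∃ M : Matching S.ToType T.ToType, (∀ s t, M.rel s t → r s.1 t.1) ∧
      ∀ s, (∀ t, ¬ M.rel s t) → s.1 ∈ U := by
  obtain ⟨P, rfl, rfl, hP⟩ := exists_pairs_of_rel h
  have hsum : ∀ (g : α × α → α) (C : Multiset α),
      (Finset.univ : Finset (P.ToType ⊕ C.ToType)).val.map
        (Sum.elim (fun p => g p.1) fun c => c.1) = P.map g + C := by
    intro g C
    rw [← Finset.univ_disjSum_univ, Finset.val_disjSum, Multiset.disjSum, Multiset.map_add,
      Multiset.map_map, Multiset.map_map]
    conv_rhs => rw [← Multiset.map_univ_coe P, Multiset.map_map, ← Multiset.map_univ_coe C]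
    rfl
  obtain ⟨e, he⟩ := exists_equiv_toType _ ((hsum Prod.fst U).trans hS.symm)
  obtain ⟨e', he'⟩ := exists_equiv_toType _ ((hsum Prod.snd U').trans hT.symm)
  refine ⟨⟨fun s t => ∃ p, e (Sum.inl p) = s ∧ e' (Sum.inl p) = t, ?_, ?_⟩, ?_, ?_⟩
  · rintro s t t' ⟨p, rfl, rfl⟩ ⟨q, hq, rfl⟩
    rw [Sum.inl_injective (e.injective hq)]
  · rintro s s' t ⟨p, rfl, rfl⟩ ⟨q, rfl, hq⟩
    rw [Sum.inl_injective (e'.injective hq)]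
  · rintro s t ⟨p, rfl, rfl⟩
    rw [he, he']
    exact hP _ (Multiset.coe_mem (x := p))
  · intro s hs
    obtain ⟨p | u, rfl⟩ := e.surjective s
    · exact absurd ⟨p, rfl, rfl⟩ (hs (e' (Sum.inl p)))
    · rw [he]
      exact Multiset.coe_mem (x := u)

theorem card_toType_fiber {α : Type*} [DecidableEq α] (m : Multiset α) (a : α) :
    Fintype.card {x : m.ToType // x.1 = a} = m.count a := by
  conv_rhs => rw [← Multiset.map_univ_coe m, Multiset.count_map]
  rw [Fintype.card_subtype, Finset.card_def]
  simp [eq_comm]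

theorem Matching.count_le {α : Type*} [DecidableEq α] {S T : Multiset α}
    (M : Matching S.ToType T.ToType) {a : α} (h1 : ∀ s t, M.rel s t → s.1 = t.1)
    (h2 : ∀ s, s.1 = a → ∃ t, M.rel s t) : S.count a ≤ T.count a := by
  rw [← card_toType_fiber, ← card_toType_fiber]
  choose f hf using h2
  refine Fintype.card_le_of_injective
    (fun s => ⟨f s.1 s.2, (h1 _ _ (hf s.1 s.2)).symm.trans s.2⟩) fun s s' h => ?_
  have h' : f s.1 s.2 = f s'.1 s'.2 := congrArg Subtype.val h
  exact Subtype.ext (M.left_unique _ _ _ (hf s.1 s.2) (h' ▸ hf s'.1 s'.2))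

/-! ### The bottleneck distance -/

/-- The point of the plane that represents an interval. -/
noncomputable def Interval.point (I : Interval n) : ℝ × ℝ :=
  (((I.1.1 : ℕ) : ℝ) + 1, ((I.1.2 : ℕ) : ℝ) + 1)

theorem Interval.point_injective : Function.Injective (Interval.point (n := n)) := by
  intro I J h
  simp only [Interval.point, Prod.mk.injEq, add_left_inj, Nat.cast_inj] at h
  exact Subtype.ext (Prod.ext (Fin.ext h.1) (Fin.ext h.2))

theorem diagCost_top (r : ℝ × ℝ) : diagCost ⊤ r = |r.2 - r.1| / 2 := by
  simp [diagCost]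

theorem norm_toLp_top (r : ℝ × ℝ) : ‖WithLp.toLp ⊤ r‖ = max |r.1| |r.2| := by
  rw [WithLp.prod_norm_eq_sup]
  rfl

theorem abs_cast_sub_cast_le {a b l : ℕ} (h1 : a ≤ b + l) (h2 : b ≤ a + l) :
    |((a : ℝ) + 1) - ((b : ℝ) + 1)| ≤ l := by
  have h1' : (a : ℝ) ≤ b + l := by exact_mod_cast h1
  have h2' : (b : ℝ) ≤ a + l := by exact_mod_cast h2
  rw [abs_le]
  constructor <;> linarith

/-- Unmatched points of `V` were simple from the start or lost on the way, so their ends are at most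
`2ℓ` apart. Nothing is said of unmatched points of `W`; the reverse sequence has to supply that. -/
theorem exists_matching_of_precsim {V : Mod F τ} {W : Mod F τ'} {R : List (Reflection n)}
    (h : Precsim (seqMod R V) W) :
    ∃ M : Matching V.dgmPoints.ToType W.dgmPoints.ToType,
      (∀ s t, M.rel s t → ‖WithLp.toLp ⊤ (s.1 - t.1)‖ ≤ R.length) ∧
      ∀ s, (∀ t, ¬ M.rel s t) → diagCost ⊤ s.1 ≤ R.length := by
  obtain ⟨A, U, h1, h2, h3⟩ := dgm_seqMod R V
  obtain ⟨U', hU'⟩ := Multiset.le_iff_exists_add.1 h.dgm_le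
  have hV : V.dgm = A + (U + V.dgm.filter fun I => ¬ I.1.1 ≠ I.1.2) := by
    rw [← add_assoc, ← h1]
    exact (Multiset.filter_add_not _ _).symm
  have hrel : Multiset.Rel (fun p q : ℝ × ℝ => ‖WithLp.toLp ⊤ (p - q)‖ ≤ R.length)
      (A.map Interval.point) ((seqMod R V).dgm.map Interval.point) := by
    refine Multiset.rel_map.2 (h2.mono fun I _ J _ hIJ => ?_)
    rw [norm_toLp_top]
    exact max_le (abs_cast_sub_cast_le hIJ.1.1 hIJ.1.2) (abs_cast_sub_cast_le hIJ.2.1 hIJ.2.2)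
  obtain ⟨M, hM1, hM2⟩ := exists_matching_of_rel (S := V.dgmPoints) (T := W.dgmPoints) hrel
    ((congrArg (Multiset.map Interval.point) hV).trans (Multiset.map_add _ _ _))
    ((congrArg (Multiset.map Interval.point) hU').trans (Multiset.map_add _ _ _))
  refine ⟨M, hM1, fun s hs => ?_⟩
  obtain ⟨I, hI, hIs⟩ := Multiset.mem_map.1 (hM2 s hs)
  have hlen : (I.1.2 : ℕ) ≤ I.1.1 + 2 * R.length := by
    rcases Multiset.mem_add.1 hI with hI | hI
    · exact h3 I hI
    · have := not_not.1 (Multiset.mem_filter.1 hI).2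
      rw [Fin.ext_iff] at this
      omega
  have hle : (I.1.1 : ℕ) ≤ I.1.2 := I.2
  rw [diagCost_top, ← hIs]
  have := abs_cast_sub_cast_le hlen (by omega)
  rw [div_le_iff₀ two_pos, mul_comm]
  rwa [Nat.cast_mul, Nat.cast_ofNat] at this

theorem cost_one (R : List (Reflection n)) : cost 1 R = R.length := by
  by_cases h : R = [] <;> simp [cost, h]

theorem bottleneckDist_le_reflectionDist (V : Mod F τ) (W : Mod F τ') :
    bottleneckDist ⊤ V.dgmPoints W.dgmPoints ≤ reflectionDist 1 V W := by
  refine le_iInf fun R => le_iInf fun R' => le_iInf fun h => ?_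
  obtain ⟨M, hM, hM'⟩ := exists_matching_of_precsim h.1
  obtain ⟨N, hN, hN'⟩ := exists_matching_of_precsim h.2
  obtain ⟨H, h1, h2, h3⟩ := M.exists_union N.swap
  rw [cost_one, cost_one]
  refine (iInf_le _ H).trans (sup_le (iSup_le fun s => iSup_le fun t => iSup_le fun hst => ?_)
    (sup_le (iSup_le fun s => iSup_le fun hs => ?_) (iSup_le fun t => iSup_le fun ht => ?_)))
  · refine ENNReal.ofReal_le_ofReal ?_
    rcases h1 s t hst with h | h
    · exact (hM s t h).trans (le_max_left _ _)
    · have := hN t s h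
      rw [norm_toLp_top, Prod.fst_sub, Prod.snd_sub, abs_sub_comm,
        abs_sub_comm (Prod.snd _)] at this
      rw [norm_toLp_top]
      exact this.trans (le_max_right _ _)
  · exact ENNReal.ofReal_le_ofReal ((hM' s (h2 s hs)).trans (le_max_left _ _))
  · exact ENNReal.ofReal_le_ofReal ((hN' t (h3 t ht)).trans (le_max_right _ _))

theorem eq_of_norm_point_sub_lt {I J : Interval n}
    (h : ‖WithLp.toLp ⊤ (I.point - J.point)‖ < 1 / 2) : I.point = J.point := by
  rw [norm_toLp_top, max_lt_iff] at h
  have key : ∀ a b : ℕ, |((a : ℝ) + 1) - ((b : ℝ) + 1)| < 1 / 2 → (a : ℝ) + 1 = b + 1 := by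
    intro a b hab
    rw [abs_lt] at hab
    have h1 : (a : ℝ) < b + 1 := by linarith
    have h2 : (b : ℝ) < a + 1 := by linarith
    have h1' : a < b + 1 := by exact_mod_cast h1
    have h2' : b < a + 1 := by exact_mod_cast h2
    rw [show a = b by omega]
  exact Prod.ext (key _ _ h.1) (key _ _ h.2)

theorem Matching.cost_swap {S T : Multiset (ℝ × ℝ)} (M : Matching S.ToType T.ToType) :
    M.swap.cost ⊤ = M.cost ⊤ := by
  unfold Matching.cost
  rw [iSup_comm, sup_comm (⨆ (s : T.ToType) (_ : ∀ t, ¬ M.swap.rel s t), _)]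
  congr 1
  refine iSup_congr fun s => iSup_congr fun t => iSup_congr fun _ => ?_
  rw [norm_toLp_top, norm_toLp_top, Prod.fst_sub, Prod.snd_sub, abs_sub_comm,
    abs_sub_comm (Prod.snd _)]
  rfl

/-- Matched points are integral and closer than `1/2`, hence equal. A nonsimple interval costs at
least `1/2` when unmatched, so each of its copies is matched. -/
theorem count_le_of_cost_lt {D E : Multiset (Interval n)}
    (M : Matching (D.map Interval.point).ToType (E.map Interval.point).ToType)
    (hM : M.cost ⊤ < ENNReal.ofReal (1 / 2)) {I : Interval n} (hI : I.1.1 ≠ I.1.2) :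
    D.count I ≤ E.count I := by
  rw [← Multiset.count_map_eq_count' _ _ Interval.point_injective,
    ← Multiset.count_map_eq_count' _ E Interval.point_injective]
  have lt_of_le : ∀ x, ENNReal.ofReal x ≤ M.cost ⊤ → x < 1 / 2 := fun x hx =>
    (ENNReal.ofReal_lt_ofReal_iff (by norm_num)).1 (hx.trans_lt hM)
  refine M.count_le (fun s t hst => ?_) fun s hs => ?_
  · obtain ⟨J, -, hJ⟩ := Multiset.mem_map.1 (Multiset.coe_mem (x := s))
    obtain ⟨K, -, hK⟩ := Multiset.mem_map.1 (Multiset.coe_mem (x := t))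
    have := lt_of_le ‖WithLp.toLp ⊤ (s.1 - t.1)‖ (le_sup_of_le_left
      (le_iSup_of_le s (le_iSup_of_le t (le_iSup_of_le hst le_rfl))))
    rw [← hJ, ← hK] at this ⊢
    exact eq_of_norm_point_sub_lt this
  · by_contra h
    push Not at h
    have h1 := lt_of_le (diagCost ⊤ s.1) (le_sup_of_le_right (le_sup_of_le_left
      (le_iSup_of_le s (le_iSup_of_le h le_rfl))))
    rw [hs, diagCost_top] at h1
    have h2 : (I.1.1 : ℕ) + 1 ≤ I.1.2 := lt_of_le_of_ne I.2 hI
    have h3 : ((I.1.1 : ℕ) : ℝ) + 1 ≤ (I.1.2 : ℕ) := by exact_mod_cast h2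
    have h4 := le_abs_self (I.point.2 - I.point.1)
    simp only [Interval.point] at h1 h4
    linarith

theorem nonsimple_dgm_eq_of_cost_lt {V : Mod F τ} {W : Mod F τ'}
    (M : Matching V.dgmPoints.ToType W.dgmPoints.ToType)
    (hM : M.cost ⊤ < ENNReal.ofReal (1 / 2)) : nonsimple V.dgm = nonsimple W.dgm := by
  ext I
  rw [nonsimple, nonsimple, Multiset.count_filter, Multiset.count_filter]
  split_ifs with h
  · exact le_antisymm (count_le_of_cost_lt M hM h)
      (count_le_of_cost_lt M.swap (M.cost_swap.trans_lt hM) h)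
  · rfl

/-! ### Zero modules -/

theorem Mod.dgm_eq_zero_iff {V : Mod F τ} : V.dgm = 0 ↔ ∀ i, Subsingleton (V.space i) := by
  classical
  have key : ∀ i, Subsingleton (V.space i) ↔ V.dgm.countP (fun I => I.Mem i ∧ I.Mem i) = 0 :=
    fun i => by rw [V.countP_dgm le_rfl, V.rank_self, Module.finrank_zero_iff]
  simp only [key, Multiset.countP_eq_zero]
  constructor
  · intro h
    simp [h]
  · intro h
    refine Multiset.eq_zero_of_forall_notMem fun I hI => ?_
    exact h I.1.1 I hI ⟨I.self_mem_left, I.self_mem_left⟩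

theorem Mod.subsingleton_removeSimple {V : Mod F τ} {i : Fin n} (h : Subsingleton (V.space i)) :
    Subsingleton (V.removeSimple.space i) := by
  classical
  have key : ∀ V : Mod F τ, Subsingleton (V.space i) ↔
      V.dgm.countP (fun I => I.Mem i ∧ I.Mem i) = 0 :=
    fun V => by rw [V.countP_dgm le_rfl, V.rank_self, Module.finrank_zero_iff]
  rw [key] at h ⊢
  rw [V.dgm_removeSimple]
  exact Nat.eq_zero_of_le_zero ((Multiset.countP_le_of_le _ (Multiset.filter_le _ _)).trans h.le)

/-- Maps between zero spaces are isomorphisms, so the arrows on which the types differ can be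
reversed one by one. -/
theorem sim_of_subsingleton {V : Mod F τ} {W : Mod F τ'} (hV : ∀ i, Subsingleton (V.space i))
    (hW : ∀ i, Subsingleton (W.space i)) : Sim V W := by
  induction hm : (Finset.univ.filter fun i => τ i ≠ τ' i).card generalizing τ with
  | zero =>
    obtain rfl : τ = τ' := funext fun i => by
      simpa using Finset.eq_empty_iff_forall_notMem.1 (Finset.card_eq_zero.1 hm) i
    exact Sim.iso (Mod.iso_of_subsingleton hV hW)
  | succ m ih =>
    obtain ⟨k, hk⟩ : (Finset.univ.filter fun i => τ i ≠ τ' i).Nonempty := by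
      rw [← Finset.card_pos, hm]
      omega
    have hiso : V.IsIsoAt k := ⟨fun h =>
      ⟨fun _ _ _ => (hV _).elim _ _, fun y => ⟨0, (hV _).elim _ _⟩⟩, fun h =>
      ⟨fun _ _ _ => (hV _).elim _ _, fun y => ⟨0, (hV _).elim _ _⟩⟩⟩
    refine Sim.reverse k hiso (ih (V := V.reverse k hiso) hV ?_)
    have : (Finset.univ.filter fun i => reverseAt k τ i ≠ τ' i) =
        (Finset.univ.filter fun i => τ i ≠ τ' i).erase k := by
      ext i
      by_cases hik : i = k
      · subst hik
        have hk' := (Finset.mem_filter.1 hk).2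
        cases h1 : τ i <;> cases h2 : τ' i <;> simp_all [reverseAt, Dir.flip]
      · rw [Finset.mem_erase, Finset.mem_filter, Finset.mem_filter]
        simp [reverseAt, hik]
    rw [this, Finset.card_erase_of_mem hk, hm]
    rfl

theorem precsim_of_dgm_le {W : Mod F τ'} {V : Mod F τ} {D : Multiset (Interval n)}
    (h : Sim W (intervalSum F τ D)) (hD : D ≤ V.dgm) : Precsim W V := by
  obtain ⟨E, hE⟩ := Multiset.le_iff_exists_add.1 hD
  refine ⟨_, h, intervalSum F τ E, Mod.iso_of_dgm_eq ?_⟩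
  rw [Mod.dgm_sum, dgm_intervalSum, dgm_intervalSum, hE]

theorem precsim_of_subsingleton {W : Mod F τ'} (hW : ∀ i, Subsingleton (W.space i))
    (V : Mod F τ) : Precsim W V :=
  precsim_of_dgm_le (D := 0) (sim_of_subsingleton hW (Mod.dgm_eq_zero_iff.1 (dgm_intervalSum 0)))
    (Multiset.zero_le _)

/-! ### A sequence of reflections that annihilates all modules -/

/-- The limit of `0 → V_k → V_{k+1}` is zero: each component is the image of the one before. At the
first position the direction `.right` puts the added `0` at the source. -/
theorem Mod.subsingleton_reflectLim {V : Mod F τ} {k : Fin n}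
    (hV : ∀ i < k, Subsingleton (V.space i)) (hτ : ∀ i, k ≤ hi i → τ i = .right) {i : Fin n}
    (hi' : i ≤ k) : Subsingleton ((V.reflectLim k .right).space i) := by
  rcases hi'.lt_or_eq with h | h
  · have := hV i h
    exact (V.limAway k .right h.ne).toEquiv.subsingleton
  · refine @Equiv.subsingleton _ _ (V.limAt k .right h).toEquiv (subsingleton_of_forall_eq 0 ?_)
    rintro ⟨x, hx⟩
    have hlt : ∀ j : Nbhd k, j.1 < k → x j = 0 := fun j hj => (hV j.1 hj).elim _ _
    have hcenter : ∀ j : Nbhd k, j.1 = k → x j = 0 := by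
      intro j hj
      by_cases h0 : (k : ℕ) = 0
      · obtain rfl : j = nbhdCenter k := Subtype.ext hj
        exact hx.2.2.1 h0 rfl
      · obtain ⟨a, ha⟩ := exists_hi_eq (b := ⟨0, by omega⟩) (d := k)
          (by simp only [Fin.lt_def]; omega)
        have ht := hτ a ha.ge
        have h1 := (congrArg (V.fwd a ht) (hlt (nbhdLo (.inr ha)) (ha ▸ lo_lt_hi a))).symm.trans
          (hx.1 a (.inr ha) ht)
        obtain rfl : j = nbhdHi (.inr ha) := Subtype.ext (hj.trans ha.symm)
        exact h1.symm.trans (map_zero (V.fwd a ht))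
    refine Subtype.ext (funext fun j => ?_)
    rcases lt_trichotomy j.1 k with hj | hj | hj
    · exact hlt j hj
    · exact hcenter j hj
    · obtain ⟨a, ha⟩ := exists_lo_eq hj
      have ht := hτ a (ha ▸ (lo_lt_hi a).le)
      have h1 := (congrArg (V.fwd a ht) (hcenter (nbhdLo (.inl ha)) ha)).symm.trans
        (hx.1 a (.inl ha) ht)
      obtain rfl : j = nbhdHi (.inl ha) := by
        have h2 := j.2.1
        have h3 : (k : ℕ) < j.1 := hj
        have h4 : (lo a : ℕ) = k := congrArg Fin.val ha
        refine Subtype.ext (Fin.ext ?_)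
        change (j.1 : ℕ) = lo a + 1
        omega
      exact h1.symm.trans (map_zero (V.fwd a ht))

/-- Here `m` is the number of positions still to be erased. A limit at `k` leaves the arrow into `k`
pointing left, but the later steps need only the arrows ending beyond `k`. -/
theorem subsingleton_seqMod_lim (m : ℕ) {τ : ZType n} (V : Mod F τ)
    (hV : ∀ i : Fin n, (i : ℕ) + m < n → Subsingleton (V.space i))
    (hτ : ∀ i, n ≤ (hi i : ℕ) + m → τ i = .right) (hm : m ≤ n) (i : Fin n) :
    Subsingleton ((seqMod (((List.finRange n).drop (n - m)).map fun k => .lim k .right) V).space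
      i) := by
  induction m generalizing τ with
  | zero =>
    rw [List.drop_eq_nil_of_le (by simp)]
    exact Mod.subsingleton_removeSimple (hV i (by omega))
  | succ m ih =>
    rw [List.drop_eq_getElem_cons (by simp; omega), List.map_cons,
      show n - (m + 1) + 1 = n - m by omega]
    refine ih _ (fun i hi' => ?_) (fun i hi' => ?_) (by omega)
    · refine Mod.subsingleton_reflectLim (fun j hj => Mod.subsingleton_removeSimple (hV j ?_))
        (fun j hj => hτ j ?_) ?_
      · simp only [Fin.lt_def, List.getElem_finRange, Fin.val_cast] at hj
        omega
      · simp only [Fin.le_def, List.getElem_finRange, Fin.val_cast] at hj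
        omega
      · simp only [Fin.le_def, List.getElem_finRange, Fin.val_cast]
        omega
    · have h1 := hτ i (by omega)
      simp only [Reflection.onType, extrovert, h1]
      split_ifs with h2 h3
      · rfl
      · simp only [Fin.ext_iff, List.getElem_finRange, Fin.val_cast] at h3
        omega
      · rfl

/-- The colimits serve only to change the type. A sink at `k` turns the arrow into `k` to the right;
the arrow leaving `k` is turned left but corrected by the next colimit, and the last position has
none. -/
theorem subsingleton_seqMod_colim_lim (m : ℕ) {τ : ZType n} (V : Mod F τ)
    (hτ : ∀ i, (hi i : ℕ) + m < n → τ i = .right) (hm : m ≤ n) (i : Fin n) :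
    Subsingleton ((seqMod (((List.finRange n).drop (n - m)).map (fun k => .colim k .right) ++
      (List.finRange n).map fun k => .lim k .right) V).space i) := by
  induction m generalizing τ with
  | zero =>
    rw [List.drop_eq_nil_of_le (by simp)]
    have := subsingleton_seqMod_lim n V (fun i hi' => by omega) (fun i _ => hτ i (by omega)) le_rfl i
    rwa [Nat.sub_self, List.drop_zero] at this
  | succ m ih =>
    rw [List.drop_eq_getElem_cons (by simp; omega), List.map_cons, List.cons_append,
      show n - (m + 1) + 1 = n - m by omega]
    refine ih _ (fun i hi' => ?_) (by omega)
    simp only [Reflection.onType, introvert]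
    split_ifs with h2 h3
    · simp only [Fin.ext_iff, List.getElem_finRange, Fin.val_cast, lo, hi] at h2 hi'
      omega
    · rfl
    · simp only [Fin.ext_iff, List.getElem_finRange, Fin.val_cast] at h3
      exact hτ i (by omega)

theorem reflectionDist_le_two_mul (V : Mod F τ) (W : Mod F τ') :
    reflectionDist 1 V W ≤ 2 * n := by
  -- The case `m = n` of the preceding lemma, where no arrow is constrained beforehand; so `R` suits
  -- both modules and all types.
  let R : List (Reflection n) := ((List.finRange n).drop (n - n)).map (fun k => .colim k .right) ++
      (List.finRange n).map fun k => .lim k .right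
  have hR : R.length = 2 * n := by simp [R]; omega
  have hp : ∀ {τ τ' : ZType n} (V : Mod F τ) (W : Mod F τ'), Precsim (seqMod R V) W := fun V W =>
    precsim_of_subsingleton (subsingleton_seqMod_colim_lim n V (fun i hi' => by omega) le_rfl) W
  refine (iInf_le_of_le R (iInf_le_of_le R (iInf_le_of_le ⟨hp V W, hp W V⟩ le_rfl))).trans ?_
  rw [max_self, cost_one, hR, ENNReal.ofReal_natCast]
  push_cast
  exact le_rfl

theorem precsim_removeSimple {V : Mod F τ} {W : Mod F τ} (h : nonsimple V.dgm = nonsimple W.dgm) :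
    Precsim V.removeSimple W :=
  precsim_of_dgm_le (Sim.iso (Mod.iso_of_dgm_eq ((V.dgm_removeSimple.trans h).trans
    (dgm_intervalSum (nonsimple W.dgm)).symm))) (Multiset.filter_le _ _)

theorem reflectionDist_eq_zero {V W : Mod F τ} (h : nonsimple V.dgm = nonsimple W.dgm) :
    reflectionDist 1 V W = 0 := by
  refine le_antisymm ((iInf_le_of_le [] (iInf_le_of_le [] (iInf_le_of_le
    ⟨precsim_removeSimple h, precsim_removeSimple h.symm⟩ le_rfl))).trans ?_) zero_le
  simp [cost]

theorem reflectionDist_le_bottleneckDist (V W : Mod F τ) :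
    reflectionDist 1 V W ≤ 2 * (n : ℝ≥0∞) ^ 2 * ((n : ℝ≥0∞) + 1) *
      bottleneckDist ⊤ V.dgmPoints W.dgmPoints := by
  by_cases h : nonsimple V.dgm = nonsimple W.dgm
  · rw [reflectionDist_eq_zero h]
    exact zero_le
  · have h1 : ENNReal.ofReal (1 / 2) ≤ bottleneckDist ⊤ V.dgmPoints W.dgmPoints :=
      le_iInf fun M => not_lt.1 fun hM => h (nonsimple_dgm_eq_of_cost_lt M hM)
    have h2 : ENNReal.ofReal (1 / 2) = 2⁻¹ := by
      rw [one_div, ENNReal.ofReal_inv_of_pos two_pos]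
      simp
    -- The extra factor `2` offsets the lower bound `1/2` on the bottleneck distance.
    have h3 : 2 * n * 2 ≤ 2 * n ^ 2 * (n + 1) := by
      rcases Nat.eq_zero_or_pos n with rfl | hn
      · simp
      · nlinarith [Nat.mul_le_mul hn hn, Nat.mul_le_mul hn (Nat.mul_le_mul hn hn)]
    have h4 : 2 * (n : ℝ≥0∞) * 2 ≤ 2 * (n : ℝ≥0∞) ^ 2 * ((n : ℝ≥0∞) + 1) := by exact_mod_cast h3
    calc reflectionDist 1 V W ≤ 2 * n := reflectionDist_le_two_mul V W
      _ = 2 * n * 2 * 2⁻¹ := by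
        rw [mul_assoc _ 2, ENNReal.mul_inv_cancel two_ne_zero ENNReal.ofNat_ne_top, mul_one]
      _ ≤ _ := mul_le_mul' h4 (h2 ▸ h1)

end Zigzag

theorem mainTheorem4 {F : Type u} [Field F] (n : ℕ) (τ : Zigzag.ZType n)
    (V W : Zigzag.Mod F τ) :
    Zigzag.reflectionDist 1 V W ≠ ⊤ ∧
    Zigzag.bottleneckDist ⊤ V.dgmPoints W.dgmPoints ≤ Zigzag.reflectionDist 1 V W ∧
    Zigzag.reflectionDist 1 V W ≤
      2 * (n : ℝ≥0∞) ^ 2 * ((n : ℝ≥0∞) + 1) *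
        Zigzag.bottleneckDist ⊤ V.dgmPoints W.dgmPoints :=
  ⟨((Zigzag.reflectionDist_le_two_mul V W).trans_lt
      (ENNReal.mul_lt_top ENNReal.ofNat_lt_top (ENNReal.natCast_lt_top n))).ne,
    Zigzag.bottleneckDist_le_reflectionDist V W, Zigzag.reflectionDist_le_bottleneckDist V W⟩
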